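/- Setting. Let $\Theta\subseteq\mathbb R^m$ be measurable and let $f(x|\theta)=\zeta(x)\exp\{\sum_{i=1}^q\eta_i(\theta)S_i(x)-A(\theta)\}$, $\theta\in\Theta$, be an exponential family of probability densities on $\mathbb R^d$. Let $N\ge 1$ and assume that for every $n\ge N$ the statistic $Y=\sum_{j=1}^n S(X_j)$ of $n$ i.i.d. observations has, given $\theta$, a density of the form $R_n(y)\exp\{\sum_i\eta_i(\theta)y_i-nA(\theta)\}$ on $\mathbb R^q$, with $R_n\ge0$ measurable. Then $T=Y/n$ has the density $f(\tau|\theta)=n^qR_n(n\tau)\exp\{n\sum_i\eta_i(\theta)\tau_i-nA(\theta)\}$. Let $\theta$ have the conjugate prior density $f(\theta)=Z(\rho,\kappa)\exp\{\sum_i\eta_i(\theta)\rho_i-\kappa A(\theta)\}$ on $\Theta$, assumed proper, and put $f(\tau,\theta)=f(\tau|\theta)f(\theta)$, $f_T(\tau)=\int_\Theta f(\tau,\theta)\,d\theta$. Fix $\tau^*\in\mathbb R^q$. Let $P$ be the posterior, with density $f(\theta|\tau^*)=f(\tau^*,\theta)/f_T(\tau^*)$; for $\varepsilon\in(0,\infty)^q$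 let $D_\varepsilon(\tau^*)=\{\tau:\sum_i|(\tau_i-\tau_i^*)/\varepsilon_i|^2\le1\}$ and let $P^\varepsilon$ have the density $$f^\varepsilon(\theta|\tau^*)=\frac{|D_\varepsilon(\tau^*)|^{-1}\int_{D_\varepsilon(\tau^*)}f(\tau,\theta)\,d\tau}{|D_\varepsilon(\tau^*)|^{-1}\int_{D_\varepsilon(\tau^*)}f_T(\tau)\,d\tau}.$$ Let $H(P|P^\varepsilon)(\tau^*)=\int\log\frac{dP}{dP^\varepsilon}\,dP$ denote relative entropy. Assumptions. (1) $\eta$ and $A$ are smooth on $\Theta$, and there is $r>0$ such that, for all $n\ge N$, $R_n$ is smooth and positive on the ball $B(n\tau^*,r)$. (2) For each $k\ge1$ there are $r_k>0$ and $C_k$ such that $|\partial_i^{(k)}\log R_n(y)|\le C_k$ for all $i=1,\dots,q$, all $n\ge N$ and all $y\in B(n\tau^*,r_k)$, where $\partial_i^{(k)}$ is the $k$-th pure partial derivative in the $i$-th coordinate. (3) The function $g(\theta)=\sum_i\eta_i(\theta)\tau_i^*-A(\theta)$ is smooth on $\Theta$ and attains its maximum over $\Theta$ at exactly one point $\theta^*$;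 this point is interior to $\Theta$ and is a non-degenerate critical point: $\nabla g(\theta^*)=0$, $\det\nabla^2g(\theta^*)\neq0$. Conclusion. There are constants $\delta>0$ and $C$, independent of $n$ and $\varepsilon$, such that for all $n\ge N$ and all $\varepsilon\in(0,\infty)^q$ with $n|\varepsilon|<\delta$: $P$ and $P^\varepsilon$ are probability measures, $P$ has finite fourth moments of each $\eta_i$, $H(P|P^\varepsilon)(\tau^*)<\infty$, and $$\left|H(P|P^\varepsilon)(\tau^*)-\frac{n^4}{8(q+2)^2}\,\mathbb E\Big[\Big(\sum_{i=1}^q\varepsilon_i^2\big(\eta_i^2-\mathbb E\eta_i^2+2\,\partial_i\log R_n(n\tau^*)(\eta_i-\mathbb E\eta_i)\big)\Big)^2\Big]\right|\le C\,|n\varepsilon|^6,$$ where $\mathbb E$ is expectation of functions of $\theta$ under $P$. -/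

import Mathlib

open MeasureTheory Set
open scoped ContDiff

noncomputable section

namespace ABC

/-- The `k`-th pure partial derivative `∂_i^{(k)} F (y)` in the `i`-th coordinate direction. -/
def iterPartial {q : ℕ} (k : ℕ) (i : Fin q) (F : EuclideanSpace ℝ (Fin q) → ℝ)
    (y : EuclideanSpace ℝ (Fin q)) : ℝ :=
  iteratedDeriv k (fun t : ℝ => F (y + t • EuclideanSpace.single i (1 : ℝ))) 0

/-- The Hessian matrix of `g` at `x`. -/
def hessian {m : ℕ} (g : EuclideanSpace ℝ (Fin m) → ℝ) (x : EuclideanSpace ℝ (Fin m)) :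
    Matrix (Fin m) (Fin m) ℝ :=
  Matrix.of fun i j =>
    iteratedFDeriv ℝ 2 g x ![EuclideanSpace.single i (1 : ℝ), EuclideanSpace.single j (1 : ℝ)]

/-- The elliptic acceptance region `D_ε(τ*)`. -/
def ellipse {q : ℕ} (ε τs : EuclideanSpace ℝ (Fin q)) : Set (EuclideanSpace ℝ (Fin q)) :=
  {τ | ∑ i, |(τ i - τs i) / ε i| ^ 2 ≤ 1}

/-- An exponential family of probability densities
`f(x|θ) = ζ(x) exp (∑ i, η_i(θ) S_i(x) - A(θ))` on `ℝ^d`, with parameter set `Θ ⊆ ℝ^m`. -/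
structure ExpFamily (d m q : ℕ) where
  Θ : Set (EuclideanSpace ℝ (Fin m))
  ζ : EuclideanSpace ℝ (Fin d) → ℝ
  S : EuclideanSpace ℝ (Fin d) → EuclideanSpace ℝ (Fin q)
  η : EuclideanSpace ℝ (Fin m) → EuclideanSpace ℝ (Fin q)
  A : EuclideanSpace ℝ (Fin m) → ℝ
  measurableSet_Θ : MeasurableSet Θ
  measurable_ζ : Measurable ζ
  measurable_S : Measurable S
  ζ_nonneg : ∀ x, 0 ≤ ζ x
  normalized : ∀ θ ∈ Θ,
    ∫⁻ x, ENNReal.ofReal (ζ x * Real.exp (∑ i, η θ i * S x i - A θ)) = 1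

namespace ExpFamily

variable {d m q : ℕ} (F : ExpFamily d m q)

/-- The law of one observation given `θ`. -/
def sampleLaw (θ : EuclideanSpace ℝ (Fin m)) : Measure (EuclideanSpace ℝ (Fin d)) :=
  volume.withDensity fun x =>
    ENNReal.ofReal (F.ζ x * Real.exp (∑ i, F.η θ i * F.S x i - F.A θ))

/-- `Rn` is the carrier function of the sufficient statistic `Y = ∑ j, S(X_j)` of `n` i.i.d.
observations: for each `θ`, the law of `Y` has the density
`Rn(y) exp (∑ i, η_i(θ) y_i - n A(θ))`. -/
structure IsStatCarrier (n : ℕ) (Rn : EuclideanSpace ℝ (Fin q) → ℝ) : Prop where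
  measurable : Measurable Rn
  nonneg : ∀ y, 0 ≤ Rn y
  law : ∀ θ ∈ F.Θ,
    (Measure.pi fun _ : Fin n => F.sampleLaw θ).map (fun x => ∑ j, F.S (x j)) =
      volume.withDensity fun y =>
        ENNReal.ofReal (Rn y * Real.exp (∑ i, F.η θ i * y i - n * F.A θ))

/-- The unnormalised conjugate prior `exp (∑ i, η_i(θ) ρ_i - κ A(θ))`. -/
def priorWeight (ρ : EuclideanSpace ℝ (Fin q)) (κ : ℝ) (θ : EuclideanSpace ℝ (Fin m)) : ℝ :=
  Real.exp (∑ i, F.η θ i * ρ i - κ * F.A θ)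

/-- The normalising factor `Z(ρ, κ)`. -/
def Z (ρ : EuclideanSpace ℝ (Fin q)) (κ : ℝ) : ℝ :=
  (∫ θ in F.Θ, F.priorWeight ρ κ θ)⁻¹

/-- The conjugate prior density `f(θ|ρ, κ)` on `Θ`. -/
def priorDensity (ρ : EuclideanSpace ℝ (Fin q)) (κ : ℝ) (θ : EuclideanSpace ℝ (Fin m)) : ℝ :=
  F.Z ρ κ * F.priorWeight ρ κ θ

/-- The density `f(τ|θ)` of `T = Y / n` given `θ`. -/
def statDensity (n : ℕ) (Rn : EuclideanSpace ℝ (Fin q) → ℝ) (τ : EuclideanSpace ℝ (Fin q))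
    (θ : EuclideanSpace ℝ (Fin m)) : ℝ :=
  (n : ℝ) ^ q * Rn ((n : ℝ) • τ) * Real.exp (n * ∑ i, F.η θ i * τ i - n * F.A θ)

/-- The joint density `f_{T,Θ}(τ, θ)`. -/
def jointDensity (ρ : EuclideanSpace ℝ (Fin q)) (κ : ℝ) (n : ℕ)
    (Rn : EuclideanSpace ℝ (Fin q) → ℝ) (τ : EuclideanSpace ℝ (Fin q))
    (θ : EuclideanSpace ℝ (Fin m)) : ℝ :=
  F.statDensity n Rn τ θ * F.priorDensity ρ κ θ

/-- The marginal density `f_T(τ)`. -/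
def marginal (ρ : EuclideanSpace ℝ (Fin q)) (κ : ℝ) (n : ℕ)
    (Rn : EuclideanSpace ℝ (Fin q) → ℝ) (τ : EuclideanSpace ℝ (Fin q)) : ℝ :=
  ∫ θ in F.Θ, F.jointDensity ρ κ n Rn τ θ

/-- The posterior `P`, the law of `Θ` given `T = τ*`, with density `f_{T,Θ}(τ*, θ) / f_T(τ*)`. -/
def posterior (ρ : EuclideanSpace ℝ (Fin q)) (κ : ℝ) (n : ℕ)
    (Rn : EuclideanSpace ℝ (Fin q) → ℝ) (τs : EuclideanSpace ℝ (Fin q)) :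
    Measure (EuclideanSpace ℝ (Fin m)) :=
  (volume.restrict F.Θ).withDensity fun θ =>
    ENNReal.ofReal (F.jointDensity ρ κ n Rn τs θ / F.marginal ρ κ n Rn τs)

/-- The simulated posterior `P^ε`, the law of `Θ` given `T ∈ D_ε(τ*)`: its density is the average
of `f_{T,Θ}(·, θ)` over `D_ε(τ*)` divided by the average of `f_T` over `D_ε(τ*)`. -/
def abcPosterior (ρ : EuclideanSpace ℝ (Fin q)) (κ : ℝ) (n : ℕ)
    (Rn : EuclideanSpace ℝ (Fin q) → ℝ) (τs ε : EuclideanSpace ℝ (Fin q)) :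
    Measure (EuclideanSpace ℝ (Fin m)) :=
  (volume.restrict F.Θ).withDensity fun θ =>
    ENNReal.ofReal ((⨍ τ in ellipse ε τs, F.jointDensity ρ κ n Rn τ θ) /
      ⨍ τ in ellipse ε τs, F.marginal ρ κ n Rn τ)

/-- Smoothness and positivity of the densities: `η` and `A` are smooth on `Θ`, and `R_n` is smooth
and positive on a ball around `n τ*` whose radius does not depend on `n`. -/
structure Regular (R : ℕ → EuclideanSpace ℝ (Fin q) → ℝ) (N : ℕ)
    (τs : EuclideanSpace ℝ (Fin q)) : Prop where
  smooth_η : ContDiffOn ℝ ∞ F.η F.Θ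
  smooth_A : ContDiffOn ℝ ∞ F.A F.Θ
  smooth_R : ∃ r : ℝ, 0 < r ∧ ∀ n ≥ N,
    ContDiffOn ℝ ∞ (R n) (Metric.ball ((n : ℝ) • τs) r) ∧
      ∀ y ∈ Metric.ball ((n : ℝ) • τs) r, 0 < R n y

/-- `g(θ) = ∑ i, η_i(θ) τ_i - A(θ)`. -/
def g (τ : EuclideanSpace ℝ (Fin q)) (θ : EuclideanSpace ℝ (Fin m)) : ℝ :=
  ∑ i, F.η θ i * τ i - F.A θ

/-- `g` is smooth and has its maximum over `Θ` only at one point, an interior non-degenerate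
critical point. -/
def UniqueNondegMax (τs : EuclideanSpace ℝ (Fin q)) : Prop :=
  ContDiffOn ℝ ∞ (F.g τs) F.Θ ∧
    ∃ θs ∈ interior F.Θ, (∀ θ ∈ F.Θ, θ ≠ θs → F.g τs θ < F.g τs θs) ∧
      gradient (F.g τs) θs = 0 ∧ (hessian (F.g τs) θs).det ≠ 0

end ExpFamily

/-- All pure partial derivatives of `log R_n`, of each order `k ≥ 1`, are bounded near `n τ*`
(on a ball of fixed radius), uniformly in `n`. -/
def LogDerivBounded {q : ℕ} (R : ℕ → EuclideanSpace ℝ (Fin q) → ℝ) (N : ℕ)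
    (τs : EuclideanSpace ℝ (Fin q)) : Prop :=
  ∀ k : ℕ, 1 ≤ k → ∃ r : ℝ, 0 < r ∧ ∃ C : ℝ, ∀ n ≥ N, ∀ y ∈ Metric.ball ((n : ℝ) • τs) r,
    ∀ i, |iterPartial k i (fun z => Real.log (R n z)) y| ≤ C

end ABC

end

open scoped SchwartzMap LineDeriv FourierTransform
open Real

namespace ABC

/-! Write `a = nε`, let `L` be the increment of `log R_n` around `nτ*`, and let `v` be uniform on
the unit ball. Rescaling the ellipse shows that `P^ε` is `P` reweighted by `h(θ) = E_v exp(L(av) +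
η(θ)·av)`, the product `av` being coordinatewise (`ExpFamily.abcPosterior_eq_withDensity`). The
relative entropy is therefore the Jensen gap `log E h - E log h` under `P`
(`klDiv_withDensity_right`).

The law of `v` is symmetric, so only even orders in `a` survive in `h`. Since `E v_i v_j =
δ_ij/(q+2)`, one gets `h = 1 + x + O(|a|^4)` with `x = const + ∑ a_i²(l_i + η_i)²/(2(q+2))` and `l_i
= ∂_i log R_n(nτ*)` (`avgRatio_expansion`). The Jensen gap is then `Var(x)/2 + O(|a|^6)`
(`abs_log_integral_sub_integral_log_le`). Constants and the squares `l_i²` drop out of the variance,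
which leaves the stated quadratic expression (`integral_sq_centered`).

Two points need uniformity in `n`. The first is a Taylor bound for `L`, although only pure partial
derivatives are controlled. After a cutoff, bounds on the pure derivatives of order `q+4` force the
Fourier transform to decay like `(1+|ξ|)^{-(q+4)}`, and the Taylor remainders of `cos` and `sin`
under the Fourier integral give the even and odd parts of `L` (`parity_bounds`).

The second is integrability of the error terms, which grow with `|η|`. The density of `Y` has mass
one, so near `Nτ*` it cannot be too large; this yields `c|η| ≤ K - N g` on `Θ`
(`ExpFamily.IsStatCarrier.exists_norm_eta_le`). The posterior is the prior tilted by `exp(n g)`,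
with `g` maximal at an interior point, so `exp(c|η|)` has bounded posterior mean for all `n ≥ N`
(`ExpFamily.exists_posterior_moment_bound`). -/

/-! ### Fourier decay from pure partial derivatives. -/

/-- Connects one-variable derivatives along a line, the form taken by `iterPartial`, with iterates
of the directional derivative on Schwartz space, where the Fourier transform turns differentiation
into multiplication. -/
lemma iteratedDeriv_schwartz_line {V G : Type*} [NormedAddCommGroup V] [NormedSpace ℝ V]
    [NormedAddCommGroup G] [NormedSpace ℝ G] (f : 𝓢(V, G)) (v x : V) (k : ℕ) :
    iteratedDeriv k (fun t : ℝ => f (x + t • v)) =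
      fun t => ((fun h : 𝓢(V, G) => ∂_{v} h)^[k] f) (x + t • v) := by
  induction k with
  | zero => simp
  | succ k ih =>
    rw [iteratedDeriv_succ, ih]
    funext t
    rw [Function.iterate_succ_apply', SchwartzMap.lineDerivOp_apply_eq_fderiv]
    set g := (fun h : 𝓢(V, G) => ∂_{v} h)^[k] f
    have h1 : HasDerivAt (fun t : ℝ => x + t • v) v t := by
      simpa using ((hasDerivAt_id t).smul_const v).const_add x
    exact ((g.differentiableAt (x := x + t • v)).hasFDerivAt.comp_hasDerivAt t h1).deriv

lemma fourier_lineDeriv_iterate {V : Type*} [NormedAddCommGroup V] [InnerProductSpace ℝ V]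
    [FiniteDimensional ℝ V] [MeasurableSpace V] [BorelSpace V]
    (f : 𝓢(V, ℂ)) (v ξ : V) (k : ℕ) :
    𝓕 ((fun h : 𝓢(V, ℂ) => ∂_{v} h)^[k] f) ξ =
      (2 * π * Complex.I * (inner ℝ ξ v : ℝ)) ^ k * 𝓕 f ξ := by
  induction k with
  | zero => simp
  | succ k ih =>
    have : (inner ℝ · v : V → ℝ).HasTemperateGrowth := by fun_prop
    rw [Function.iterate_succ_apply', SchwartzMap.fourier_lineDerivOp_eq]
    simp only [smul_apply, SchwartzMap.smulLeftCLM_apply_apply this, ih]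
    simp only [smul_eq_mul, Complex.real_smul]
    ring

lemma norm_fourier_le_integral {V : Type*} [NormedAddCommGroup V] [InnerProductSpace ℝ V]
    [FiniteDimensional ℝ V] [MeasurableSpace V] [BorelSpace V] (f : 𝓢(V, ℂ)) (ξ : V) :
    ‖𝓕 f ξ‖ ≤ ∫ x, ‖f x‖ := by
  simpa [SchwartzMap.norm_toLp_one] using SchwartzMap.norm_fourier_apply_le_toLp_one f ξ

lemma schwartz_eq_integral_fourier {V : Type*} [NormedAddCommGroup V] [InnerProductSpace ℝ V]
    [FiniteDimensional ℝ V] [MeasurableSpace V] [BorelSpace V] (f : 𝓢(V, ℂ)) (x : V) :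
    f x = ∫ ξ, Complex.exp ((2 * π * inner ℝ ξ x : ℝ) * Complex.I) * 𝓕 f ξ := by
  have h : 𝓕⁻ (𝓕 f) = f := FourierTransform.fourierInv_fourier_eq f
  conv_lhs => rw [← h, SchwartzMap.fourierInv_coe, Real.fourierInv_eq']
  simp

lemma norm_le_of_abs_le {q : ℕ} {M : ℝ} {ξ : EuclideanSpace ℝ (Fin q)} (h : ∀ i, |ξ i| ≤ M) :
    ‖ξ‖ ≤ q * M := by
  calc ‖ξ‖ = ‖∑ i, EuclideanSpace.single i (ξ i)‖ := by
        congr 1; ext j; simp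
    _ ≤ ∑ i, ‖EuclideanSpace.single i (ξ i)‖ := norm_sum_le _ _
    _ ≤ ∑ i : Fin q, M := Finset.sum_le_sum fun i _ => by simpa using h i
    _ = q * M := by simp

/-- Coordinatewise bounds on the derivatives of order `K` control the decay of the Fourier
transform. -/
lemma fourier_decay {q : ℕ} (K : ℕ) {B : ℝ} (f : 𝓢(EuclideanSpace ℝ (Fin q), ℂ))
    (h0 : ∫ x, ‖f x‖ ≤ B)
    (hK : ∀ i : Fin q, ∫ x, ‖((fun h : 𝓢(EuclideanSpace ℝ (Fin q), ℂ) =>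
      ∂_{EuclideanSpace.single i (1 : ℝ)} h)^[K] f) x‖ ≤ B) (ξ : EuclideanSpace ℝ (Fin q)) :
    (1 + ‖ξ‖) ^ K * ‖𝓕 f ξ‖ ≤ (1 + q : ℝ) ^ K * B := by
  have hB : 0 ≤ B := le_trans (by positivity) h0
  have hi : ∀ i, |ξ i| ^ K * ‖𝓕 f ξ‖ ≤ B := by
    intro i
    have h1 := (norm_fourier_le_integral _ ξ).trans (hK i)
    rw [fourier_lineDeriv_iterate, norm_mul, norm_pow] at h1
    -- The multiplier has modulus `2π|ξ_i|`, and the factor `2π` is dropped since it exceeds one.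
    refine le_trans (mul_le_mul_of_nonneg_right (pow_le_pow_left₀ (abs_nonneg _) ?_ _)
      (norm_nonneg _)) h1
    rw [EuclideanSpace.inner_single_right]
    simp only [norm_mul, Complex.norm_ofNat, Complex.norm_real, Complex.norm_I, mul_one]
    simp only [Real.norm_eq_abs, abs_of_pos Real.pi_pos, conj_trivial, abs_one, one_mul]
    nlinarith [abs_nonneg (ξ i), Real.pi_gt_three]
  have h00 : ‖𝓕 f ξ‖ ≤ B := (norm_fourier_le_integral _ ξ).trans h0
  -- `M` is the larger of 1 and the largest coordinate of `ξ`: the bound of order zero or the pure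
  -- derivative in that coordinate then controls `M ^ K`. This is why no mixed derivatives are
  -- needed.
  obtain ⟨M, hM1, hM2, hM3⟩ : ∃ M : ℝ, 1 ≤ M ∧ (∀ i, |ξ i| ≤ M) ∧ M ^ K * ‖𝓕 f ξ‖ ≤ B := by
    rcases isEmpty_or_nonempty (Fin q) with he | hne
    · exact ⟨1, le_rfl, fun i => (he.false i).elim, by simpa using h00⟩
    · obtain ⟨j, hj⟩ := Finite.exists_max (fun i => |ξ i|)
      rcases le_total |ξ j| 1 with h | h
      · exact ⟨1, le_rfl, fun i => (hj i).trans h, by simpa using h00⟩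
      · exact ⟨|ξ j|, h, hj, hi j⟩
  have hnorm : ‖ξ‖ ≤ q * M := norm_le_of_abs_le hM2
  calc (1 + ‖ξ‖) ^ K * ‖𝓕 f ξ‖ ≤ ((1 + q) * M) ^ K * ‖𝓕 f ξ‖ := by
        gcongr; nlinarith
    _ = (1 + q : ℝ) ^ K * (M ^ K * ‖𝓕 f ξ‖) := by rw [mul_pow]; ring
    _ ≤ (1 + q : ℝ) ^ K * B := by gcongr

/-! ### Cutoffs, and Fourier representation near the centre of a ball. -/

lemma contDiffAt_line {V : Type*} [NormedAddCommGroup V] [NormedSpace ℝ V] {f : V → ℝ} {s : Set V}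
    (hs : IsOpen s) (hf : ContDiffOn ℝ ∞ f s) {y : V} (hy : y ∈ s) (v : V) (k : ℕ) :
    ContDiffAt ℝ k (fun t : ℝ => f (y + t • v)) 0 := by
  have h1 : ContDiffAt ℝ ∞ f (y + (0 : ℝ) • v) := by
    simpa using hf.contDiffAt (hs.mem_nhds hy)
  have h2 : ContDiffAt ℝ ∞ (fun t : ℝ => y + t • v) 0 := by fun_prop
  exact (ContDiffAt.comp (0 : ℝ) h1 h2).of_le (by exact_mod_cast le_top)

/-- Multiplication by a smooth function of compact support inside `ball 0 r` extends a function
that is smooth on that ball to a smooth function. -/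
lemma contDiff_mul_of_tsupport_subset {V : Type*} [NormedAddCommGroup V] [NormedSpace ℝ V]
    {χ L : V → ℝ} {s : Set V} (hs : IsOpen s)
    (hχ : ContDiff ℝ ∞ χ) (hL : ContDiffOn ℝ ∞ L s) (hsub : tsupport χ ⊆ s) :
    ContDiff ℝ ∞ (fun y => χ y * L y) := by
  rw [contDiff_iff_contDiffAt]
  intro y
  by_cases hy : y ∈ tsupport χ
  · exact hχ.contDiffAt.mul (hL.contDiffAt (hs.mem_nhds (hsub hy)))
  · have : (fun y => χ y * L y) =ᶠ[nhds y] fun _ => 0 := by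
      filter_upwards [notMem_tsupport_iff_eventuallyEq.1 hy] with z hz
      simp [hz]
    exact contDiffAt_const.congr_of_eventuallyEq this

lemma norm_iteratedDeriv_ofReal (k : ℕ) (f : ℝ → ℝ) (hf : ContDiffAt ℝ k f 0) :
    ‖iteratedDeriv k (fun t => (f t : ℂ)) 0‖ = |iteratedDeriv k f 0| := by
  rw [← norm_iteratedFDeriv_eq_norm_iteratedDeriv, ← Real.norm_eq_abs,
    ← norm_iteratedFDeriv_eq_norm_iteratedDeriv]
  exact Complex.ofRealLI.norm_iteratedFDeriv_comp_left hf le_rfl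

/-- Leibniz bound for pure partial derivatives of a product. -/
lemma abs_iterPartial_mul_le {q : ℕ} {χ L : EuclideanSpace ℝ (Fin q) → ℝ}
    {s : Set (EuclideanSpace ℝ (Fin q))} (hs : IsOpen s) (hχ : ContDiffOn ℝ ∞ χ s)
    (hL : ContDiffOn ℝ ∞ L s) {y : EuclideanSpace ℝ (Fin q)} (hy : y ∈ s) (i : Fin q) (k : ℕ)
    {C D : ℝ} (hD : ∀ j ≤ k, |iterPartial j i χ y| ≤ D) (hC : ∀ j ≤ k, |iterPartial j i L y| ≤ C) :
    |iterPartial k i (fun z => χ z * L z) y| ≤ 2 ^ k * (D * C) := by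
  have h := iteratedDerivWithin_mul (n := k) (mem_univ (0 : ℝ)) uniqueDiffOn_univ
    (contDiffAt_line hs hχ hy (EuclideanSpace.single i 1) k).contDiffWithinAt
    (contDiffAt_line hs hL hy (EuclideanSpace.single i 1) k).contDiffWithinAt
  simp only [iteratedDerivWithin_univ] at h
  have h' : iterPartial k i (fun z => χ z * L z) y =
      ∑ j ∈ Finset.range (k + 1), k.choose j * iterPartial j i χ y * iterPartial (k - j) i L y := h
  have hD0 : 0 ≤ D := (abs_nonneg _).trans (hD 0 (Nat.zero_le _))
  rw [h']
  calc _ ≤ ∑ j ∈ Finset.range (k + 1),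
        |k.choose j * iterPartial j i χ y * iterPartial (k - j) i L y| :=
        Finset.abs_sum_le_sum_abs _ _
    _ ≤ ∑ j ∈ Finset.range (k + 1), (k.choose j : ℝ) * (D * C) := by
        refine Finset.sum_le_sum fun j hj => ?_
        have hj' : j ≤ k := Nat.lt_succ_iff.1 (Finset.mem_range.1 hj)
        rw [abs_mul, abs_mul, Nat.abs_cast, mul_assoc]
        have := hD j hj'
        have := hC (k - j) (Nat.sub_le _ _)
        gcongr
    _ = 2 ^ k * (D * C) := by
        rw [← Finset.sum_mul]
        congr 1
        exact_mod_cast Nat.sum_range_choose k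

lemma abs_cos_sub_one_le (x : ℝ) : |cos x - 1| ≤ x ^ 2 := by
  rw [abs_le]
  constructor <;>
    nlinarith [Real.one_sub_sq_div_two_le_cos (x := x), Real.cos_le_one x, sq_nonneg x]

lemma abs_sin_sub_le (x : ℝ) : |sin x - x| ≤ |x| ^ 3 := by
  have key : ∀ x : ℝ, 0 ≤ x → |sin x - x| ≤ x ^ 3 := by
    intro x hx
    have h1 : sin x ≤ x := Real.sin_le hx
    rw [abs_le]
    refine ⟨?_, by nlinarith [pow_nonneg hx 3]⟩
    rcases hx.eq_or_lt with rfl | hx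
    · simp
    have := Real.sin_gt_sub_cube hx
    nlinarith [pow_nonneg hx.le 3]
  rcases le_total 0 x with h | h
  · rw [abs_of_nonneg h]; exact key x h
  · have := key (-x) (by linarith)
    rw [abs_of_nonpos h]
    rw [Real.sin_neg, ← abs_neg] at this
    convert this using 2
    ring

/-- A function with bounded pure partial derivatives on a ball agrees near the centre with the
inverse Fourier transform of a function whose decay depends only on the bounds. -/
lemma exists_fourier_representation (q : ℕ) {r : ℝ} (hr : 0 < r) (C : ℝ) :
    ∃ M : ℝ, ∀ L : EuclideanSpace ℝ (Fin q) → ℝ, ContDiffOn ℝ ∞ L (Metric.ball 0 r) →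
      (∀ y ∈ Metric.ball (0 : EuclideanSpace ℝ (Fin q)) r, |L y| ≤ C) →
      (∀ k ≤ q + 4, 1 ≤ k → ∀ y ∈ Metric.ball (0 : EuclideanSpace ℝ (Fin q)) r, ∀ i,
        |iterPartial k i L y| ≤ C) →
      ∃ Φ : 𝓢(EuclideanSpace ℝ (Fin q), ℂ), (∀ ξ, (1 + ‖ξ‖) ^ (q + 4) * ‖Φ ξ‖ ≤ M) ∧
        ∀ u, ‖u‖ < r / 4 →
          (L u : ℂ) = ∫ ξ, Complex.exp ((2 * π * inner ℝ ξ u : ℝ) * Complex.I) * Φ ξ := by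
  set E := EuclideanSpace ℝ (Fin q) with hE
  let χ : ContDiffBump (0 : E) := ⟨r / 4, r / 2, by positivity, by linarith⟩
  let X : 𝓢(E, ℝ) := χ.hasCompactSupport.toSchwartzMap χ.contDiff
  have hX : ∀ y, X y = χ y := fun y => rfl
  let e : Fin q → E := fun i => EuclideanSpace.single i (1 : ℝ)
  -- A common bound for the cutoff's pure derivatives of orders `0, …, q + 4`, chosen before `L`.
  -- The leading 1 gives `D ≥ 1`, so that `b` also bounds the cut-off function itself.
  let D : ℝ := 1 + ∑ j ∈ Finset.range (q + 5), ∑ i,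
    SchwartzMap.seminorm ℝ 0 0 ((fun h : 𝓢(E, ℝ) => ∂_{e i} h)^[j] X)
  have hD : ∀ j ≤ q + 4, ∀ i y, |iterPartial j i χ y| ≤ D := by
    intro j hj i y
    have h1 : iterPartial j i χ y = ((fun h : 𝓢(E, ℝ) => ∂_{e i} h)^[j] X) y := by
      have := congrFun (iteratedDeriv_schwartz_line X (e i) y j) 0
      simp only [zero_smul, add_zero] at this
      exact this
    rw [h1, ← Real.norm_eq_abs]
    refine (SchwartzMap.norm_le_seminorm ℝ _ y).trans ?_
    have h2 : SchwartzMap.seminorm ℝ 0 0 ((fun h : 𝓢(E, ℝ) => ∂_{e i} h)^[j] X) ≤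
        ∑ i, SchwartzMap.seminorm ℝ 0 0 ((fun h : 𝓢(E, ℝ) => ∂_{e i} h)^[j] X) :=
      Finset.single_le_sum (f := fun i => SchwartzMap.seminorm ℝ 0 0
        ((fun h : 𝓢(E, ℝ) => ∂_{e i} h)^[j] X)) (fun i _ => apply_nonneg _ _) (Finset.mem_univ i)
    have h3 := Finset.single_le_sum (f := fun j => ∑ i, SchwartzMap.seminorm ℝ 0 0
        ((fun h : 𝓢(E, ℝ) => ∂_{e i} h)^[j] X))
        (fun j _ => Finset.sum_nonneg fun i _ => apply_nonneg _ _)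
        (Finset.mem_range.2 (Nat.lt_succ_of_le hj))
    have h4 := h2.trans h3
    simp only [D]
    linarith
  have hD1 : 1 ≤ D := by
    simp only [D]
    have : 0 ≤ ∑ j ∈ Finset.range (q + 5), ∑ i,
      SchwartzMap.seminorm ℝ 0 0 ((fun h : 𝓢(E, ℝ) => ∂_{e i} h)^[j] X) :=
      Finset.sum_nonneg fun j _ => Finset.sum_nonneg fun i _ => apply_nonneg _ _
    linarith
  let b : ℝ := 2 ^ (q + 4) * (D * C)
  let B : ℝ := b * volume.real (Metric.closedBall (0 : E) (r / 2))
  refine ⟨(1 + q : ℝ) ^ (q + 4) * B, fun L hL hL0 hLk => ?_⟩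
  have hsub : tsupport χ ⊆ Metric.ball (0 : E) r := by
    rw [χ.tsupport_eq]
    exact Metric.closedBall_subset_ball (by change r / 2 < r; linarith)
  have hsmooth : ContDiff ℝ ∞ (fun y => χ y * L y) :=
    contDiff_mul_of_tsupport_subset Metric.isOpen_ball χ.contDiff hL hsub
  have hsmoothC : ContDiff ℝ ∞ (fun y => ((χ y * L y : ℝ) : ℂ)) :=
    Complex.ofRealCLM.contDiff.comp hsmooth
  have hcpt : HasCompactSupport (fun y => ((χ y * L y : ℝ) : ℂ)) := by
    refine χ.hasCompactSupport.mono fun y hy => ?_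
    simp only [Function.mem_support] at hy ⊢
    intro h
    simp [h] at hy
  let φ : 𝓢(E, ℂ) := hcpt.toSchwartzMap hsmoothC
  have hφ : ∀ y, φ y = ((χ y * L y : ℝ) : ℂ) := fun y => rfl
  have hC0 : 0 ≤ C := (abs_nonneg _).trans (hL0 0 (Metric.mem_ball_self hr))
  have hball : ∀ y, y ∈ tsupport χ → y ∈ Metric.closedBall (0 : E) (r / 2) := by
    intro y hy
    rwa [χ.tsupport_eq] at hy
  have hpart : ∀ i y, ‖((fun h : 𝓢(E, ℂ) => ∂_{e i} h)^[q + 4] φ) y‖ ≤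
      (Metric.closedBall (0 : E) (r / 2)).indicator (fun _ => b) y := by
    intro i y
    have h1 : ((fun h : 𝓢(E, ℂ) => ∂_{e i} h)^[q + 4] φ) y =
        iteratedDeriv (q + 4) (fun t : ℝ => ((χ (y + t • e i) * L (y + t • e i) : ℝ) : ℂ)) 0 := by
      have := congrFun (iteratedDeriv_schwartz_line φ (e i) y (q + 4)) 0
      simp only [zero_smul, add_zero] at this
      exact this.symm
    rw [h1]
    by_cases hy : y ∈ tsupport χ
    · have hyb := hsub hy
      rw [indicator_of_mem (hball y hy), norm_iteratedDeriv_ofReal]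
      · refine abs_iterPartial_mul_le Metric.isOpen_ball χ.contDiff.contDiffOn hL hyb i (q + 4)
          (fun j hj => hD j hj i y) fun j hj => ?_
        rcases Nat.eq_zero_or_pos j with rfl | hj0
        · simpa [iterPartial] using hL0 y hyb
        · exact hLk j hj hj0 y hyb i
      · exact contDiffAt_line isOpen_univ hsmooth.contDiffOn (mem_univ y) (e i) (q + 4)
    -- Off the support of the cutoff the product vanishes on a neighbourhood, so every derivative
    -- along a line is zero, whatever `L` does there.
    · have h2 : (fun t : ℝ => ((χ (y + t • e i) * L (y + t • e i) : ℝ) : ℂ)) =ᶠ[nhds 0]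
          fun _ => 0 := by
        have hc : Filter.Tendsto (fun t : ℝ => y + t • e i) (nhds 0) (nhds y) := by
          have : Continuous (fun t : ℝ => y + t • e i) := by fun_prop
          simpa using this.tendsto 0
        filter_upwards [hc.eventually (notMem_tsupport_iff_eventuallyEq.1 hy)] with t ht
        simp [ht]
      rw [(h2.iteratedDeriv (q + 4)).self_of_nhds]
      have : iteratedDeriv (q + 4) (fun _ : ℝ => (0 : ℂ)) 0 = 0 := by
        simp
      rw [this, norm_zero]
      exact indicator_nonneg (fun _ _ => by positivity) y
  have hzero : ∀ y, ‖φ y‖ ≤ (Metric.closedBall (0 : E) (r / 2)).indicator (fun _ => b) y := by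
    intro y
    rw [hφ]
    by_cases hy : y ∈ tsupport χ
    · rw [indicator_of_mem (hball y hy), Complex.norm_real, norm_mul, Real.norm_eq_abs,
        Real.norm_eq_abs]
      have h1 : |χ y| ≤ 1 := by rw [abs_of_nonneg χ.nonneg]; exact χ.le_one
      have h2 := hL0 y (hsub hy)
      calc |χ y| * |L y| ≤ 1 * C := by gcongr
        _ ≤ D * C := by gcongr
        _ ≤ 2 ^ (q + 4) * (D * C) :=
          le_mul_of_one_le_left (by positivity) (one_le_pow₀ (by norm_num))
    · have : χ y = 0 := image_eq_zero_of_notMem_tsupport hy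
      rw [this]
      simpa using indicator_nonneg (fun _ _ => by positivity) y
  have hfin : volume (Metric.closedBall (0 : E) (r / 2)) ≠ ⊤ := measure_closedBall_lt_top.ne
  have h_int : ∀ f : 𝓢(E, ℂ),
      (∀ y, ‖f y‖ ≤ (Metric.closedBall (0 : E) (r / 2)).indicator (fun _ => b) y) →
      ∫ y, ‖f y‖ ≤ B := by
    intro f hf
    have hi : Integrable ((Metric.closedBall (0 : E) (r / 2)).indicator (fun _ => b)) :=
      (integrableOn_const hfin).integrable_indicator
        Metric.isClosed_closedBall.measurableSet
    refine (integral_mono f.integrable.norm hi hf).trans (le_of_eq ?_)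
    rw [integral_indicator Metric.isClosed_closedBall.measurableSet, setIntegral_const,
      smul_eq_mul, mul_comm]
  refine ⟨𝓕 φ, fourier_decay (q + 4) φ (h_int _ hzero) (fun i => h_int _ (hpart i)), fun u hu => ?_⟩
  -- The cutoff equals 1 on the ball of radius `r / 4`, so Fourier inversion returns `L` itself
  -- there.
  rw [← schwartz_eq_integral_fourier, hφ, χ.one_of_mem_closedBall, one_mul]
  simpa using hu.le

/-! ### Even and odd parts with uniform remainders. -/

lemma exp_mul_I_add_exp_neg_mul_I (x : ℝ) :
    Complex.exp (x * Complex.I) + Complex.exp ((-x : ℝ) * Complex.I) = ((2 * cos x : ℝ) : ℂ) := by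
  rw [Complex.exp_mul_I, Complex.exp_mul_I]
  push_cast
  rw [Complex.cos_neg, Complex.sin_neg]
  ring

lemma exp_mul_I_sub_exp_neg_mul_I (x : ℝ) :
    Complex.exp (x * Complex.I) - Complex.exp ((-x : ℝ) * Complex.I) =
      ((2 * sin x : ℝ) : ℂ) * Complex.I := by
  rw [Complex.exp_mul_I, Complex.exp_mul_I]
  push_cast
  rw [Complex.cos_neg, Complex.sin_neg]
  ring

/-- Uniform Taylor bounds for the even and the odd part of a Fourier integral. -/
lemma fourier_parity_bounds (q : ℕ) (M₀ : ℝ) :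
    ∃ M : ℝ, 0 ≤ M ∧ ∀ Φ : 𝓢(EuclideanSpace ℝ (Fin q), ℂ),
      (∀ ξ, (1 + ‖ξ‖) ^ (q + 4) * ‖Φ ξ‖ ≤ M₀) → ∀ f : EuclideanSpace ℝ (Fin q) → ℂ,
      (∀ u, f u = ∫ ξ, Complex.exp ((2 * π * inner ℝ ξ u : ℝ) * Complex.I) * Φ ξ) →
      (∀ u, ‖f u + f (-u) - 2 * f 0‖ ≤ M * ‖u‖ ^ 2) ∧
      ∃ ℓ : EuclideanSpace ℝ (Fin q) →ₗ[ℝ] ℂ,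
        ∀ u, ‖(f u - f (-u)) / 2 - ℓ u‖ ≤ M * ‖u‖ ^ 3 := by
  set E := EuclideanSpace ℝ (Fin q) with hE
  -- Of the `q + 4` powers of decay, `q + 1` make an integrable weight on a `q`-dimensional space;
  -- the other three absorb up to three factors `‖ξ‖` from the Taylor remainders.
  let w : E → ℝ := fun ξ => (1 + ‖ξ‖) ^ (-((q : ℝ) + 1))
  have hw : Integrable w := integrable_one_add_norm (by rw [finrank_euclideanSpace_fin]; simp)
  have hw0 : ∀ ξ, 0 ≤ w ξ := fun ξ => by positivity
  have hI : 0 ≤ ∫ ξ, w ξ := integral_nonneg hw0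
  -- One constant for both estimates: it dominates `2(2π)²` from the cosine bound and `(2π)³` from
  -- the sine bound.
  let M := 2 * (2 * π) ^ 3 * (|M₀| * ∫ ξ, w ξ)
  refine ⟨M, by positivity, fun Φ hΦ f hf => ?_⟩
  have hdecay : ∀ j ≤ 3, ∀ ξ, ‖ξ‖ ^ j * ‖Φ ξ‖ ≤ |M₀| * w ξ := by
    intro j hj ξ
    have h1 : (1 : ℝ) ≤ 1 + ‖ξ‖ := by simp
    have h2 : ‖ξ‖ ^ j ≤ (1 + ‖ξ‖) ^ 3 :=
      (pow_le_pow_left₀ (norm_nonneg _) (by simp) j).trans (pow_le_pow_right₀ h1 hj)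
    have h3 : w ξ = ((1 + ‖ξ‖) ^ (q + 1))⁻¹ := by
      simp only [w]
      rw [Real.rpow_neg (by positivity)]
      norm_cast
    rw [h3, ← div_eq_mul_inv, le_div_iff₀ (by positivity)]
    calc ‖ξ‖ ^ j * ‖Φ ξ‖ * (1 + ‖ξ‖) ^ (q + 1)
        ≤ (1 + ‖ξ‖) ^ 3 * ‖Φ ξ‖ * (1 + ‖ξ‖) ^ (q + 1) := by gcongr
      _ = (1 + ‖ξ‖) ^ (q + 4) * ‖Φ ξ‖ := by ring
      _ ≤ |M₀| := (hΦ ξ).trans (le_abs_self _)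
  have h_int : ∀ u : E,
      Integrable (fun ξ => Complex.exp ((2 * π * inner ℝ ξ u : ℝ) * Complex.I) * Φ ξ) := by
    intro u
    refine Φ.integrable.norm.mono' (by fun_prop) (ae_of_all _ fun ξ => ?_)
    rw [norm_mul, Complex.norm_exp_ofReal_mul_I, one_mul]
  have hintl : ∀ u : E,
      Integrable (fun ξ => ((2 * π * inner ℝ ξ u : ℝ) : ℂ) * Complex.I * Φ ξ) := by
    intro u
    refine ((Φ.integrable_pow_mul volume 1).const_mul (2 * π * ‖u‖)).mono' (by fun_prop)
      (ae_of_all _ fun ξ => ?_)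
    rw [norm_mul, norm_mul, Complex.norm_I, mul_one, Complex.norm_real, norm_mul, pow_one,
      Real.norm_of_nonneg (by positivity)]
    have := norm_inner_le_norm (𝕜 := ℝ) ξ u
    calc 2 * π * ‖inner ℝ ξ u‖ * ‖Φ ξ‖ ≤ 2 * π * (‖ξ‖ * ‖u‖) * ‖Φ ξ‖ := by gcongr
      _ = _ := by ring
  have hbound : ∀ (G : E → ℂ) (c : ℝ) (j : ℕ), j ≤ 3 → 0 ≤ c →
      (∀ ξ, ‖G ξ‖ ≤ c * (‖ξ‖ ^ j * ‖Φ ξ‖)) → ‖∫ ξ, G ξ‖ ≤ c * (|M₀| * ∫ ξ, w ξ) := by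
    intro G c j hj hc hG
    refine (norm_integral_le_of_norm_le ((hw.const_mul |M₀|).const_mul c)
      (ae_of_all _ fun ξ => (hG ξ).trans (mul_le_mul_of_nonneg_left (hdecay j hj ξ) hc))).trans ?_
    rw [integral_const_mul, integral_const_mul]
  have hinner : ∀ ξ u : E, |2 * π * inner ℝ ξ u| ≤ 2 * π * (‖ξ‖ * ‖u‖) := by
    intro ξ u
    rw [abs_mul, abs_of_pos (by positivity)]
    have := abs_real_inner_le_norm ξ u
    gcongr
  have hpi : 1 ≤ 2 * π := by linarith [Real.pi_gt_three]
  constructor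
  · intro u
    have h1 : f u + f (-u) - 2 * f 0 =
        ∫ ξ, ((2 * (cos (2 * π * inner ℝ ξ u) - 1) : ℝ) : ℂ) * Φ ξ := by
      rw [hf u, hf (-u), hf 0, ← integral_const_mul, ← integral_add (h_int u) (h_int (-u)),
        ← integral_sub ((h_int u).fun_add (h_int (-u))) ((h_int 0).const_mul 2)]
      congr 1
      funext ξ
      have := exp_mul_I_add_exp_neg_mul_I (2 * π * inner ℝ ξ u)
      simp only [inner_neg_right, inner_zero_right, mul_zero, Complex.ofReal_zero, zero_mul,
        Complex.exp_zero, mul_neg] at this ⊢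
      rw [← add_mul, this]
      push_cast
      ring
    rw [h1]
    refine (hbound _ (2 * (2 * π) ^ 2 * ‖u‖ ^ 2) 2 (by norm_num) (by positivity)
      fun ξ => ?_).trans ?_
    · rw [norm_mul, Complex.norm_real, norm_mul, Real.norm_eq_abs, Real.norm_eq_abs, abs_two]
      calc 2 * |cos (2 * π * inner ℝ ξ u) - 1| * ‖Φ ξ‖
          ≤ 2 * (2 * π * (‖ξ‖ * ‖u‖)) ^ 2 * ‖Φ ξ‖ := by
            gcongr
            refine (abs_cos_sub_one_le _).trans ?_
            rw [← sq_abs]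
            gcongr
            exact hinner ξ u
        _ = _ := by ring
    · have : (2 * π) ^ 2 ≤ (2 * π) ^ 3 := pow_le_pow_right₀ hpi (by norm_num)
      calc _ = 2 * (2 * π) ^ 2 * (|M₀| * ∫ ξ, w ξ) * ‖u‖ ^ 2 := by ring
        _ ≤ 2 * (2 * π) ^ 3 * (|M₀| * ∫ ξ, w ξ) * ‖u‖ ^ 2 := by gcongr
  -- The linear form is the formal derivative at 0 under the integral sign. Subtracting it from the
  -- odd part replaces `sin x` by `sin x - x`.
  · refine ⟨{ toFun := fun u => ∫ ξ, ((2 * π * inner ℝ ξ u : ℝ) : ℂ) * Complex.I * Φ ξ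
              map_add' := fun u v => ?_
              map_smul' := fun c u => ?_ }, fun u => ?_⟩
    · rw [← integral_add (hintl u) (hintl v)]
      congr 1
      funext ξ
      rw [inner_add_right]
      push_cast
      ring
    · rw [RingHom.id_apply, ← integral_smul]
      congr 1
      funext ξ
      rw [inner_smul_right, Complex.real_smul]
      push_cast
      ring
    · have h1 : (f u - f (-u)) / 2 - ∫ ξ, ((2 * π * inner ℝ ξ u : ℝ) : ℂ) * Complex.I * Φ ξ =
          ∫ ξ, ((sin (2 * π * inner ℝ ξ u) - 2 * π * inner ℝ ξ u : ℝ) : ℂ) *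
            (Complex.I * Φ ξ) := by
        have hs : Integrable (fun ξ => Complex.exp ((2 * π * inner ℝ ξ u : ℝ) * Complex.I) * Φ ξ -
            Complex.exp ((2 * π * inner ℝ ξ (-u) : ℝ) * Complex.I) * Φ ξ) :=
          (h_int u).sub (h_int (-u))
        rw [hf u, hf (-u), ← integral_sub (h_int u) (h_int (-u)), div_eq_inv_mul,
          ← integral_const_mul,
          ← integral_sub (hs.const_mul _) (hintl u)]
        congr 1
        funext ξ
        have := exp_mul_I_sub_exp_neg_mul_I (2 * π * inner ℝ ξ u)
        simp only [inner_neg_right, mul_neg] at this ⊢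
        rw [← sub_mul, this]
        push_cast
        ring
      simp only [LinearMap.coe_mk, AddHom.coe_mk]
      rw [h1]
      refine (hbound _ ((2 * π) ^ 3 * ‖u‖ ^ 3) 3 le_rfl (by positivity) fun ξ => ?_).trans ?_
      · rw [norm_mul, Complex.norm_real, norm_mul, Complex.norm_I, one_mul, Real.norm_eq_abs]
        calc |sin (2 * π * inner ℝ ξ u) - 2 * π * inner ℝ ξ u| * ‖Φ ξ‖
            ≤ (2 * π * (‖ξ‖ * ‖u‖)) ^ 3 * ‖Φ ξ‖ := by
              gcongr
              refine (abs_sin_sub_le _).trans ?_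
              gcongr
              exact hinner ξ u
          _ = _ := by ring
      · calc _ = (2 * π) ^ 3 * (|M₀| * ∫ ξ, w ξ) * ‖u‖ ^ 3 := by ring
          _ ≤ 2 * (2 * π) ^ 3 * (|M₀| * ∫ ξ, w ξ) * ‖u‖ ^ 3 := by
            gcongr
            linarith [show 0 ≤ (2 * π) ^ 3 by positivity]

/-- If all pure partial derivatives of `L` are bounded on a ball, then the even part of `L` is
quadratically small and the odd part is linear up to a cubic error, uniformly in `L`. -/
lemma parity_bounds (q : ℕ) {r : ℝ} (hr : 0 < r) (C : ℝ) :
    ∃ M : ℝ, 0 ≤ M ∧ ∀ L : EuclideanSpace ℝ (Fin q) → ℝ, ContDiffOn ℝ ∞ L (Metric.ball 0 r) →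
      (∀ y ∈ Metric.ball (0 : EuclideanSpace ℝ (Fin q)) r, |L y| ≤ C) →
      (∀ k ≤ q + 4, 1 ≤ k → ∀ y ∈ Metric.ball (0 : EuclideanSpace ℝ (Fin q)) r, ∀ i,
        |iterPartial k i L y| ≤ C) → L 0 = 0 →
      ∀ u, ‖u‖ < r / 4 → |L u + L (-u)| ≤ M * ‖u‖ ^ 2 ∧
        |(L u - L (-u)) / 2 - ∑ i, iterPartial 1 i L 0 * u i| ≤ M * ‖u‖ ^ 3 := by
  obtain ⟨M₀, hM₀⟩ := exists_fourier_representation q hr C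
  obtain ⟨M, hM, h⟩ := fourier_parity_bounds q M₀
  refine ⟨M, hM, fun L hL hL0 hLk hzero => ?_⟩
  obtain ⟨Φ, hΦ, hrep⟩ := hM₀ L hL hL0 hLk
  obtain ⟨heven, ℓ, hodd⟩ := h Φ hΦ _ fun u => rfl
  have he : ∀ u, ‖u‖ < r / 4 → |L u + L (-u)| ≤ M * ‖u‖ ^ 2 := by
    intro u hu
    have := heven u
    rw [← hrep u hu, ← hrep (-u) (by simpa using hu), ← hrep 0 (by simpa using hr), hzero] at this
    simpa [← Complex.ofReal_add, Complex.norm_real] using this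
  have ho : ∀ u, ‖u‖ < r / 4 → ‖(((L u - L (-u)) / 2 : ℝ) : ℂ) - ℓ u‖ ≤ M * ‖u‖ ^ 3 := by
    intro u hu
    have := hodd u
    rw [← hrep u hu, ← hrep (-u) (by simpa using hu)] at this
    simpa using this
  -- Along a coordinate axis the even part is `O(t²)` and the odd part is `t ℓ(e_i) + O(t³)`, so
  -- `ℓ(e_i)` is the derivative at 0. By uniqueness it is the partial derivative of `L`.
  have hℓ : ∀ i, ℓ (EuclideanSpace.single i 1) = (iterPartial 1 i L 0 : ℂ) := by
    intro i
    have hd : DifferentiableAt ℝ (fun t : ℝ => L (0 + t • EuclideanSpace.single i (1 : ℝ))) 0 :=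
      (contDiffAt_line Metric.isOpen_ball hL (Metric.mem_ball_self hr) _ 1).differentiableAt
        (by norm_num)
    have h1 : HasDerivAt (fun t : ℝ => (L (0 + t • EuclideanSpace.single i (1 : ℝ)) : ℂ))
        (iterPartial 1 i L 0 : ℂ) 0 := by
      have := hd.hasDerivAt.ofReal_comp
      simpa [iterPartial] using this
    refine HasDerivAt.unique ?_ h1
    rw [hasDerivAt_iff_isLittleO]
    have hO : (fun t : ℝ => (L (0 + t • EuclideanSpace.single i (1 : ℝ)) : ℂ) -
        L (0 + (0 : ℝ) • EuclideanSpace.single i (1 : ℝ)) -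
        (t - 0) • ℓ (EuclideanSpace.single i 1)) =O[nhds 0] fun t : ℝ => t ^ 2 := by
      refine Asymptotics.IsBigO.of_bound (M * 2) ?_
      have hev : ∀ᶠ t : ℝ in nhds 0, |t| < min (r / 4) 1 := by
        have : Filter.Tendsto (fun t : ℝ => |t|) (nhds 0) (nhds 0) := by
          simpa using continuous_abs.tendsto (0 : ℝ)
        exact this.eventually (gt_mem_nhds (by positivity))
      filter_upwards [hev] with t ht
      set v := t • (EuclideanSpace.single i (1 : ℝ) : EuclideanSpace ℝ (Fin q)) with hv
      have hvn : ‖v‖ = |t| := by simp [hv, norm_smul]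
      have hvr : ‖v‖ < r / 4 := by rw [hvn]; exact ht.trans_le (min_le_left _ _)
      have e1 := he v hvr
      have e2 := ho v hvr
      rw [hvn] at e1 e2
      have hsplit : (L (0 + v) : ℂ) - L (0 + (0 : ℝ) • EuclideanSpace.single i (1 : ℝ)) -
          (t - 0) • ℓ (EuclideanSpace.single i 1) =
          (((L v + L (-v)) / 2 : ℝ) : ℂ) + ((((L v - L (-v)) / 2 : ℝ) : ℂ) - ℓ v) := by
        have : ℓ v = t • ℓ (EuclideanSpace.single i 1) := by rw [hv, map_smul]
        rw [this]
        simp only [zero_smul, zero_add, add_zero, hzero, sub_zero]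
        push_cast
        ring
      rw [hsplit]
      refine (norm_add_le _ _).trans ?_
      rw [Complex.norm_real, Real.norm_eq_abs, Real.norm_eq_abs, abs_div, abs_two, abs_pow]
      have h3 : |t| ^ 3 ≤ |t| ^ 2 :=
        pow_le_pow_of_le_one (abs_nonneg _) (ht.le.trans (min_le_right _ _)) (by norm_num)
      have h4 : M * |t| ^ 3 ≤ M * |t| ^ 2 := by gcongr
      have h5 : 0 ≤ M * |t| ^ 2 := by positivity
      linarith
    refine hO.trans_isLittleO ?_
    simpa using Asymptotics.isLittleO_pow_id (𝕜 := ℝ) (n := 2) (by norm_num)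
  intro u hu
  refine ⟨he u hu, ?_⟩
  have hu' : ℓ u = ((∑ i, iterPartial 1 i L 0 * u i : ℝ) : ℂ) := by
    have : u = ∑ i, u i • (EuclideanSpace.single i (1 : ℝ) : EuclideanSpace ℝ (Fin q)) := by
      ext j; simp [Pi.single_apply]
    conv_lhs => rw [this, map_sum]
    push_cast
    refine Finset.sum_congr rfl fun i _ => ?_
    rw [map_smul, hℓ, Complex.real_smul, mul_comm]
  have := ho u hu
  rw [hu', ← Complex.ofReal_sub, Complex.norm_real] at this
  exact this

/-! ### Uniform control of the increments of `log R_n`. -/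

/-- The radius and the constant depend on the order of derivative, but only finitely many orders are
needed, so a smallest radius and a largest constant exist. -/
lemma LogDerivBounded.exists_uniform {q : ℕ} {R : ℕ → EuclideanSpace ℝ (Fin q) → ℝ} {N : ℕ}
    {τs : EuclideanSpace ℝ (Fin q)} (h : LogDerivBounded R N τs) (K : ℕ) :
    ∃ r : ℝ, 0 < r ∧ ∃ C : ℝ, 0 ≤ C ∧ ∀ k ≤ K, 1 ≤ k → ∀ n ≥ N,
      ∀ y ∈ Metric.ball ((n : ℝ) • τs) r, ∀ i,
        |iterPartial k i (fun z => Real.log (R n z)) y| ≤ C := by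
  induction K with
  | zero => exact ⟨1, one_pos, 0, le_rfl, fun k hk hk' => by omega⟩
  | succ K ih =>
    obtain ⟨r, hr, C, hC, H⟩ := ih
    obtain ⟨r', hr', C', H'⟩ := h (K + 1) (by omega)
    refine ⟨min r r', lt_min hr hr', max C C', hC.trans (le_max_left _ _),
      fun k hk hk' n hn y hy i => ?_⟩
    rcases Nat.lt_or_ge K k with h1 | h1
    · obtain rfl : k = K + 1 := by omega
      exact (H' n hn y (Metric.ball_subset_ball (min_le_right _ _) hy) i).trans (le_max_right _ _)
    · exact (H k h1 hk' n hn y (Metric.ball_subset_ball (min_le_left _ _) hy) i).trans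
        (le_max_left _ _)

lemma iterPartial_translate_sub_const {q : ℕ} (k : ℕ) (hk : 1 ≤ k) (i : Fin q)
    (f : EuclideanSpace ℝ (Fin q) → ℝ) (x y : EuclideanSpace ℝ (Fin q)) (c : ℝ) :
    iterPartial k i (fun u => f (x + u) - c) y = iterPartial k i f (x + y) := by
  unfold iterPartial
  have : (fun t : ℝ => f (x + (y + t • EuclideanSpace.single i (1 : ℝ))) - c) =
      fun t : ℝ => -c + f (x + y + t • EuclideanSpace.single i (1 : ℝ)) := by
    funext t
    rw [add_assoc]
    ring
  rw [this, iteratedDeriv_const_add (by omega)]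

/-- Bounds on the first partial derivatives control the increments. -/
lemma abs_le_of_iterPartial_one_le {q : ℕ} {L : EuclideanSpace ℝ (Fin q) → ℝ} {r C : ℝ}
    (hr : 0 < r) (hL : ContDiffOn ℝ ∞ L (Metric.ball 0 r)) (h0 : L 0 = 0) (hC : 0 ≤ C)
    (h : ∀ y ∈ Metric.ball (0 : EuclideanSpace ℝ (Fin q)) r, ∀ i, |iterPartial 1 i L y| ≤ C)
    {y : EuclideanSpace ℝ (Fin q)} (hy : y ∈ Metric.ball 0 r) : |L y| ≤ q * C * r := by
  have hdiff : ∀ z ∈ Metric.ball (0 : EuclideanSpace ℝ (Fin q)) r, DifferentiableAt ℝ L z :=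
    fun z hz => (hL.contDiffAt (Metric.isOpen_ball.mem_nhds hz)).differentiableAt (by simp)
  have hf : ∀ z ∈ Metric.ball (0 : EuclideanSpace ℝ (Fin q)) r, ‖fderiv ℝ L z‖ ≤ q * C := by
    intro z hz
    have hp : ∀ i, fderiv ℝ L z (EuclideanSpace.single i 1) = iterPartial 1 i L z := by
      intro i
      unfold iterPartial
      rw [iteratedDeriv_one]
      have h1 : HasDerivAt (fun t : ℝ => z + t • (EuclideanSpace.single i (1 : ℝ) :
          EuclideanSpace ℝ (Fin q))) (EuclideanSpace.single i 1) 0 := by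
        simpa using ((hasDerivAt_id (0 : ℝ)).smul_const
          (EuclideanSpace.single i (1 : ℝ) : EuclideanSpace ℝ (Fin q))).const_add z
      have h2 : HasFDerivAt L (fderiv ℝ L z) (z + (0 : ℝ) • EuclideanSpace.single i (1 : ℝ)) := by
        simpa using (hdiff z hz).hasFDerivAt
      exact (h2.comp_hasDerivAt (0 : ℝ) h1).deriv.symm
    refine ContinuousLinearMap.opNorm_le_bound _ (by positivity) fun v => ?_
    have hv : v = ∑ i, v i • (EuclideanSpace.single i (1 : ℝ) : EuclideanSpace ℝ (Fin q)) := by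
      ext j; simp [Pi.single_apply]
    conv_lhs => rw [hv, map_sum]
    calc ‖∑ i, fderiv ℝ L z (v i • EuclideanSpace.single i (1 : ℝ))‖
        ≤ ∑ i, ‖fderiv ℝ L z (v i • EuclideanSpace.single i (1 : ℝ))‖ := norm_sum_le _ _
      _ ≤ ∑ i : Fin q, C * ‖v‖ := by
          refine Finset.sum_le_sum fun i _ => ?_
          rw [map_smul, hp, norm_smul, mul_comm]
          have h1 := h z hz i
          have h2 := PiLp.norm_apply_le v i
          rw [Real.norm_eq_abs (iterPartial 1 i L z)]
          gcongr
      _ = q * C * ‖v‖ := by simp; ring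
  -- Mean value inequality on the convex ball. It supplies the bound of order zero, which the
  -- hypotheses on derivatives of order at least one do not contain.
  have := (convex_ball (0 : EuclideanSpace ℝ (Fin q)) r).norm_image_sub_le_of_norm_fderiv_le
    hdiff hf (Metric.mem_ball_self hr) hy
  rw [h0, sub_zero, sub_zero, Real.norm_eq_abs] at this
  refine this.trans ?_
  have : ‖y‖ ≤ r := by
    rw [mem_ball_zero_iff] at hy
    exact hy.le
  gcongr

/-- The increment of `log Rn` around `y₀`. -/
noncomputable def logInc {q : ℕ} (Rn : EuclideanSpace ℝ (Fin q) → ℝ)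
    (y₀ u : EuclideanSpace ℝ (Fin q)) : ℝ :=
  Real.log (Rn (y₀ + u)) - Real.log (Rn y₀)

/-- The values of `log R_n` need not be bounded in `n`, only its derivatives are. Subtracting the
value at `nτ*` leaves those derivatives unchanged, and the first-order ones then bound the
increment, so `parity_bounds` applies with constants free of `n`. -/
lemma ExpFamily.Regular.exists_logInc_bounds {d m q : ℕ} {F : ExpFamily d m q}
    {R : ℕ → EuclideanSpace ℝ (Fin q) → ℝ} {N : ℕ} {τs : EuclideanSpace ℝ (Fin q)}
    (hreg : F.Regular R N τs) (hlog : LogDerivBounded R N τs) :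
    ∃ r : ℝ, 0 < r ∧ ∃ M : ℝ, 0 ≤ M ∧ ∀ n ≥ N,
      (∀ u, ‖u‖ < r → 0 < R n ((n : ℝ) • τs + u)) ∧
      (∀ i, |iterPartial 1 i (fun y => Real.log (R n y)) ((n : ℝ) • τs)| ≤ M) ∧
      ∀ u, ‖u‖ < r →
        |logInc (R n) ((n : ℝ) • τs) u + logInc (R n) ((n : ℝ) • τs) (-u)| ≤ M * ‖u‖ ^ 2 ∧
        |(logInc (R n) ((n : ℝ) • τs) u - logInc (R n) ((n : ℝ) • τs) (-u)) / 2 -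
          ∑ i, iterPartial 1 i (fun y => Real.log (R n y)) ((n : ℝ) • τs) * u i| ≤
            M * ‖u‖ ^ 3 := by
  obtain ⟨r₁, hr₁, hR⟩ := hreg.smooth_R
  obtain ⟨r₂, hr₂, C, hC, hb⟩ := hlog.exists_uniform (q + 4)
  set r := min r₁ r₂ with hr_def
  have hr : 0 < r := lt_min hr₁ hr₂
  obtain ⟨M, hM, hpar⟩ := parity_bounds q hr (max C (q * C * r))
  refine ⟨r / 4, by positivity, max M C, hM.trans (le_max_left _ _), fun n hn => ?_⟩
  obtain ⟨hsm, hpos⟩ := hR n hn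
  have hmem₁ : ∀ u, u ∈ Metric.ball (0 : EuclideanSpace ℝ (Fin q)) r →
      (n : ℝ) • τs + u ∈ Metric.ball ((n : ℝ) • τs) r₁ := by
    intro u hu
    have : ‖u‖ < r := by simpa using hu
    simpa using this.trans_le (min_le_left _ _)
  have hmem₂ : ∀ u, u ∈ Metric.ball (0 : EuclideanSpace ℝ (Fin q)) r →
      (n : ℝ) • τs + u ∈ Metric.ball ((n : ℝ) • τs) r₂ := by
    intro u hu
    have : ‖u‖ < r := by simpa using hu
    simpa using this.trans_le (min_le_right _ _)
  have hL : ContDiffOn ℝ ∞ (logInc (R n) ((n : ℝ) • τs)) (Metric.ball 0 r) := by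
    unfold logInc
    refine ContDiffOn.sub ?_ contDiffOn_const
    refine ContDiffOn.log ?_ fun u hu => (hpos _ (hmem₁ u hu)).ne'
    exact hsm.comp (by fun_prop) fun u hu => hmem₁ u hu
  have hL0 : logInc (R n) ((n : ℝ) • τs) 0 = 0 := by simp [logInc]
  have hLk : ∀ k ≤ q + 4, 1 ≤ k → ∀ y ∈ Metric.ball (0 : EuclideanSpace ℝ (Fin q)) r, ∀ i,
      |iterPartial k i (logInc (R n) ((n : ℝ) • τs)) y| ≤ C := by
    intro k hk hk1 y hy i
    have := iterPartial_translate_sub_const k hk1 i (fun y => Real.log (R n y)) ((n : ℝ) • τs) y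
      (Real.log (R n ((n : ℝ) • τs)))
    unfold logInc
    rw [this]
    exact hb k hk hk1 n hn _ (hmem₂ y hy) i
  have hbd := hpar _ hL (fun y hy => (abs_le_of_iterPartial_one_le hr hL hL0 hC
    (hLk 1 (by omega) le_rfl) hy).trans (le_max_right _ _))
    (fun k hk hk1 y hy i => (hLk k hk hk1 y hy i).trans (le_max_left _ _)) hL0
  have hone : ∀ i, iterPartial 1 i (logInc (R n) ((n : ℝ) • τs)) 0 =
      iterPartial 1 i (fun y => Real.log (R n y)) ((n : ℝ) • τs) := by
    intro i
    have := iterPartial_translate_sub_const 1 le_rfl i (fun y => Real.log (R n y)) ((n : ℝ) • τs) 0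
      (Real.log (R n ((n : ℝ) • τs)))
    rw [add_zero] at this
    exact this
  refine ⟨fun u hu => hpos _ (hmem₁ u (by simpa using hu.trans (by linarith))), fun i => ?_,
    fun u hu => ?_⟩
  · rw [← hone]
    exact (hLk 1 (by omega) le_rfl 0 (Metric.mem_ball_self hr) i).trans (le_max_right _ _)
  · obtain ⟨h1, h2⟩ := hbd u hu
    simp only [hone] at h2
    exact ⟨h1.trans (by gcongr; exact le_max_left _ _), h2.trans (by gcongr; exact le_max_left _ _)⟩

/-! ### Moments of the uniform law on the unit ball, and averages over ellipses. -/

/-- The uniform distribution on the closed unit ball. -/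
noncomputable def ballLaw (q : ℕ) : Measure (EuclideanSpace ℝ (Fin q)) :=
  (volume (Metric.closedBall (0 : EuclideanSpace ℝ (Fin q)) 1))⁻¹ •
    volume.restrict (Metric.closedBall 0 1)

lemma volume_closedBall_ne_zero (q : ℕ) :
    volume (Metric.closedBall (0 : EuclideanSpace ℝ (Fin q)) 1) ≠ 0 :=
  (Metric.measure_closedBall_pos volume _ one_pos).ne'

lemma volume_closedBall_ne_top (q : ℕ) :
    volume (Metric.closedBall (0 : EuclideanSpace ℝ (Fin q)) 1) ≠ ⊤ :=
  measure_closedBall_lt_top.ne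

instance (q : ℕ) : IsProbabilityMeasure (ballLaw q) := by
  constructor
  simp only [ballLaw, Measure.smul_apply, Measure.restrict_apply_univ, smul_eq_mul]
  exact ENNReal.inv_mul_cancel (volume_closedBall_ne_zero q) (volume_closedBall_ne_top q)

lemma integral_ballLaw {q : ℕ} (f : EuclideanSpace ℝ (Fin q) → ℝ) :
    ∫ v, f v ∂ballLaw q =
      (volume.real (Metric.closedBall (0 : EuclideanSpace ℝ (Fin q)) 1))⁻¹ *
        ∫ v in Metric.closedBall 0 1, f v := by
  rw [ballLaw, integral_smul_measure, ENNReal.toReal_inv, smul_eq_mul]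
  rfl

lemma ae_ballLaw_norm_le (q : ℕ) : ∀ᵐ v ∂ballLaw q, ‖v‖ ≤ 1 := by
  refine Measure.ae_smul_measure ?_ _
  filter_upwards [ae_restrict_mem Metric.isClosed_closedBall.measurableSet] with v hv
  simpa using hv

lemma integral_ballLaw_comp {q : ℕ}
    (U : EuclideanSpace ℝ (Fin q) ≃ₗᵢ[ℝ] EuclideanSpace ℝ (Fin q))
    (f : EuclideanSpace ℝ (Fin q) → ℝ) :
    ∫ v, f (U v) ∂ballLaw q = ∫ v, f v ∂ballLaw q := by
  rw [integral_ballLaw, integral_ballLaw]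
  congr 1
  have hpre : U ⁻¹' Metric.closedBall (0 : EuclideanSpace ℝ (Fin q)) 1 = Metric.closedBall 0 1 := by
    ext v; simp
  have := U.measurePreserving.setIntegral_preimage_emb U.toHomeomorph.measurableEmbedding f
    (Metric.closedBall 0 1)
  rwa [hpre] at this

lemma integral_ballLaw_neg {q : ℕ} (f : EuclideanSpace ℝ (Fin q) → ℝ) :
    ∫ v, f (-v) ∂ballLaw q = ∫ v, f v ∂ballLaw q :=
  integral_ballLaw_comp (LinearIsometryEquiv.neg ℝ) f

lemma integrable_ballLaw_of_continuous {q : ℕ} {f : EuclideanSpace ℝ (Fin q) → ℝ}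
    (hf : Continuous f) : Integrable f (ballLaw q) :=
  (hf.continuousOn.integrableOn_compact (isCompact_closedBall _ _)).smul_measure
    (by simpa using volume_closedBall_ne_zero q)

/-- The reflection of the `i`-th coordinate preserves the law and changes the sign of the integrand.
-/
lemma integral_ballLaw_mul_of_ne {q : ℕ} {i j : Fin q} (hij : i ≠ j) :
    ∫ v, v i * v j ∂ballLaw q = 0 := by
  let U : EuclideanSpace ℝ (Fin q) ≃ₗᵢ[ℝ] EuclideanSpace ℝ (Fin q) :=
    LinearIsometryEquiv.piLpCongrRight 2 fun k =>
      if k = i then LinearIsometryEquiv.neg ℝ else LinearIsometryEquiv.refl ℝ ℝ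
  have hU : ∀ v : EuclideanSpace ℝ (Fin q), U v i * U v j = -(v i * v j) := by
    intro v
    simp [U, hij.symm]
  have := integral_ballLaw_comp U (fun v => v i * v j)
  simp only [hU, integral_neg] at this
  linarith

lemma integral_ballLaw_sq_eq {q : ℕ} (i j : Fin q) :
    ∫ v, v i ^ 2 ∂ballLaw q = ∫ v, v j ^ 2 ∂ballLaw q := by
  let U : EuclideanSpace ℝ (Fin q) ≃ₗᵢ[ℝ] EuclideanSpace ℝ (Fin q) :=
    LinearIsometryEquiv.piLpCongrLeft 2 ℝ ℝ (Equiv.swap i j)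
  have hU : ∀ v : EuclideanSpace ℝ (Fin q), U v j = v i := by
    intro v
    simp [U, LinearIsometryEquiv.piLpCongrLeft_apply]
  have := integral_ballLaw_comp U (fun v => v j ^ 2)
  simpa only [hU] using this

/-- In polar coordinates the mean is `q ∫₀¹ y^{q-1} y² dy`. Dimension zero is separate because of
the exponent `q - 1`. -/
lemma integral_ballLaw_norm_sq (q : ℕ) : ∫ v, ‖v‖ ^ 2 ∂ballLaw q = q / (q + 2) := by
  rcases Nat.eq_zero_or_pos q with rfl | hq
  · have : ∀ v : EuclideanSpace ℝ (Fin 0), ‖v‖ ^ 2 = 0 := fun v => by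
      simp [Subsingleton.elim v 0]
    simp [this]
  have : Nonempty (Fin q) := ⟨⟨0, hq⟩⟩
  rw [integral_ballLaw, ← integral_indicator Metric.isClosed_closedBall.measurableSet]
  have h1 : (Metric.closedBall (0 : EuclideanSpace ℝ (Fin q)) 1).indicator (fun v => ‖v‖ ^ 2) =
      fun v => (Iic (1 : ℝ)).indicator (fun y => y ^ 2) ‖v‖ := by
    funext v
    by_cases h : ‖v‖ ≤ 1
    · rw [indicator_of_mem (by simpa using h), indicator_of_mem (by simpa using h)]
    · rw [indicator_of_notMem (by simpa using h), indicator_of_notMem (by simpa using h)]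
  rw [h1, integral_fun_norm_addHaar, finrank_euclideanSpace_fin]
  have h2 : ∫ y in Ioi (0 : ℝ), y ^ (q - 1) • (Iic (1 : ℝ)).indicator (fun y => y ^ 2) y =
      1 / (q + 2) := by
    have : (fun y : ℝ => y ^ (q - 1) • (Iic (1 : ℝ)).indicator (fun y => y ^ 2) y) =
        (Iic (1 : ℝ)).indicator fun y => y ^ (q + 1) := by
      funext y
      by_cases h : y ≤ 1
      · rw [indicator_of_mem (by simpa using h), indicator_of_mem (by simpa using h), smul_eq_mul,
          ← pow_add]
        congr 1
        omega
      · rw [indicator_of_notMem (by simpa using h), indicator_of_notMem (by simpa using h),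
          smul_zero]
    rw [this, setIntegral_indicator measurableSet_Iic, Ioi_inter_Iic,
      ← intervalIntegral.integral_of_le zero_le_one, integral_pow]
    push_cast
    norm_num
    ring
  have h3 : volume.real (Metric.ball (0 : EuclideanSpace ℝ (Fin q)) 1) =
      volume.real (Metric.closedBall (0 : EuclideanSpace ℝ (Fin q)) 1) := by
    simp only [Measure.real]
    rw [Measure.addHaar_closedBall_eq_addHaar_ball]
  have h4 : volume.real (Metric.closedBall (0 : EuclideanSpace ℝ (Fin q)) 1) ≠ 0 :=
    (ENNReal.toReal_ne_zero.2 ⟨volume_closedBall_ne_zero q, volume_closedBall_ne_top q⟩)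
  rw [h2, h3, nsmul_eq_mul, smul_eq_mul]
  field_simp

/-- By exchange of coordinates all `q` second moments agree, and they sum to `q/(q+2)`. -/
lemma integral_ballLaw_sq {q : ℕ} (i : Fin q) : ∫ v, v i ^ 2 ∂ballLaw q = 1 / (q + 2) := by
  have hq : (q : ℝ) ≠ 0 := by
    have := i.pos
    positivity
  have h : ∑ j : Fin q, ∫ v, v j ^ 2 ∂ballLaw q = q / (q + 2) := by
    rw [← integral_ballLaw_norm_sq, ← integral_finsetSum]
    · simp [EuclideanSpace.real_norm_sq_eq]
    · exact fun j _ => integrable_ballLaw_of_continuous (by fun_prop)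
  rw [Finset.sum_congr rfl fun j _ => integral_ballLaw_sq_eq j i] at h
  simp only [Finset.sum_const, Finset.card_univ, Fintype.card_fin, nsmul_eq_mul] at h
  field_simp at h ⊢
  linarith

/-- The second moment of a linear form under the uniform distribution on the unit ball. -/
lemma integral_ballLaw_linear_sq {q : ℕ} (b : Fin q → ℝ) :
    ∫ v, (∑ i, b i * v i) ^ 2 ∂ballLaw q = (∑ i, b i ^ 2) / (q + 2) := by
  have h1 : ∀ v : EuclideanSpace ℝ (Fin q),
      (∑ i, b i * v i) ^ 2 = ∑ i, ∑ j, b i * b j * (v i * v j) := by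
    intro v
    rw [sq, Finset.sum_mul_sum]
    refine Finset.sum_congr rfl fun i _ => Finset.sum_congr rfl fun j _ => by ring
  simp only [h1]
  rw [integral_finsetSum _ fun i _ => integrable_ballLaw_of_continuous (by fun_prop),
    Finset.sum_div]
  refine Finset.sum_congr rfl fun i _ => ?_
  rw [integral_finsetSum _ fun j _ => integrable_ballLaw_of_continuous (by fun_prop),
    Finset.sum_eq_single i]
  · rw [integral_const_mul]
    have : (fun v : EuclideanSpace ℝ (Fin q) => v i * v i) = fun v => v i ^ 2 := by
      funext v; ring
    rw [this, integral_ballLaw_sq]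
    ring
  · intro j _ hj
    rw [integral_const_mul, integral_ballLaw_mul_of_ne hj.symm, mul_zero]
  · simp

/-- Coordinatewise multiplication by `a`. -/
noncomputable def scale {q : ℕ} (a v : EuclideanSpace ℝ (Fin q)) : EuclideanSpace ℝ (Fin q) :=
  WithLp.toLp 2 fun i => a i * v i

@[simp] lemma scale_apply {q : ℕ} (a v : EuclideanSpace ℝ (Fin q)) (i : Fin q) :
    scale a v i = a i * v i := rfl

lemma scale_neg {q : ℕ} (a v : EuclideanSpace ℝ (Fin q)) : scale a (-v) = -scale a v := by
  ext i; simp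

lemma continuous_scale {q : ℕ} (a : EuclideanSpace ℝ (Fin q)) : Continuous (scale a) := by
  unfold scale
  fun_prop

lemma norm_scale_le {q : ℕ} (a v : EuclideanSpace ℝ (Fin q)) : ‖scale a v‖ ≤ ‖a‖ * ‖v‖ := by
  refine abs_le_of_sq_le_sq' ?_ (by positivity) |>.2
  rw [EuclideanSpace.real_norm_sq_eq, mul_pow, EuclideanSpace.real_norm_sq_eq a, Finset.sum_mul]
  refine Finset.sum_le_sum fun i _ => ?_
  rw [scale_apply, mul_pow]
  have : v i ^ 2 ≤ ‖v‖ ^ 2 := by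
    rw [← sq_abs, ← Real.norm_eq_abs]
    gcongr
    exact PiLp.norm_apply_le v i
  gcongr

/-- Averaging over the ellipse is averaging over the unit ball after rescaling. -/
lemma setAverage_ellipse {q : ℕ} {ε : EuclideanSpace ℝ (Fin q)} (hε : ∀ i, 0 < ε i)
    (τs : EuclideanSpace ℝ (Fin q)) (f : EuclideanSpace ℝ (Fin q) → ℝ) :
    ⨍ τ in ellipse ε τs, f τ = ∫ v, f (τs + scale ε v) ∂ballLaw q := by
  let T : EuclideanSpace ℝ (Fin q) ≃ₗ[ℝ] EuclideanSpace ℝ (Fin q) :=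
    { toFun := scale ε
      invFun := fun v => WithLp.toLp 2 fun i => v i / ε i
      map_add' := fun u v => by ext i; simp [mul_add]
      map_smul' := fun c v => by ext i; simp; ring
      left_inv := fun v => by ext i; simp [(hε i).ne']
      right_inv := fun v => by ext i; simp [mul_div_cancel₀, (hε i).ne'] }
  let D : EuclideanSpace ℝ (Fin q) →L[ℝ] EuclideanSpace ℝ (Fin q) :=
    T.toContinuousLinearEquiv
  have hD : ∀ v, D v = scale ε v := fun v => rfl
  have hdet : |D.det| ≠ 0 := by
    rw [abs_ne_zero]
    exact (LinearEquiv.isUnit_det' T).ne_zero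
  have himage : (fun v => τs + scale ε v) '' Metric.closedBall 0 1 = ellipse ε τs := by
    ext τ
    have key : ∀ v : EuclideanSpace ℝ (Fin q),
        v ∈ Metric.closedBall (0 : EuclideanSpace ℝ (Fin q)) 1
        ↔ ∑ i, |v i| ^ 2 ≤ 1 := by
      intro v
      rw [mem_closedBall_zero_iff, ← sq_le_one_iff₀ (norm_nonneg _), EuclideanSpace.real_norm_sq_eq]
      simp
    constructor
    · rintro ⟨v, hv, rfl⟩
      rw [key] at hv
      simp only [ellipse, mem_ofPred_eq]
      convert hv using 4 with i
      simp [(hε i).ne']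
    · intro h
      refine ⟨WithLp.toLp 2 fun i => (τ i - τs i) / ε i, ?_, ?_⟩
      · rw [key]
        exact h
      · ext i
        simp [mul_div_cancel₀, (hε i).ne']
  have hinj : InjOn (fun v => τs + scale ε v) (Metric.closedBall 0 1) := by
    intro u _ v _ h
    exact T.injective (add_left_cancel h)
  have hder : ∀ v ∈ Metric.closedBall (0 : EuclideanSpace ℝ (Fin q)) 1,
      HasFDerivWithinAt (fun v => τs + scale ε v) D (Metric.closedBall 0 1) v := fun v _ =>
    ((D.hasFDerivAt (x := v)).const_add τs).hasFDerivWithinAt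
  -- The Jacobian of the rescaling appears both here and in the volume of the ellipse, so it cancels
  -- in the average.
  have h_int : ∀ g : EuclideanSpace ℝ (Fin q) → ℝ, ∫ τ in ellipse ε τs, g τ =
      |D.det| * ∫ v in Metric.closedBall 0 1, g (τs + scale ε v) := by
    intro g
    rw [← himage, integral_image_eq_integral_abs_det_fderiv_smul volume
      Metric.isClosed_closedBall.measurableSet hder hinj, ← integral_const_mul]
    rfl
  have hvol : volume.real (ellipse ε τs) =
      |D.det| * volume.real (Metric.closedBall (0 : EuclideanSpace ℝ (Fin q)) 1) := by
    have := h_int fun _ => 1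
    simpa using this
  rw [setAverage_eq, hvol, h_int, integral_ballLaw, smul_eq_mul]
  field_simp

/-! ### The Jensen gap of the logarithm and relative entropy. -/

/-- The left-hand function vanishes at 0 and has derivative `z²/(1+z)`, which is at most `2y²`
between 0 and `y` because `1 + z ≥ 1/2` there; the mean value inequality concludes. -/
lemma abs_log_one_add_sub_le {y : ℝ} (hy : -(1 / 2) ≤ y) :
    |log (1 + y) - y + y ^ 2 / 2| ≤ 2 * |y| ^ 3 := by
  have hpos : ∀ z ∈ uIcc 0 y, 1 / 2 ≤ 1 + z := by
    intro z hz
    rcases le_total 0 y with h | h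
    · rw [uIcc_of_le h] at hz; linarith [hz.1]
    · rw [uIcc_of_ge h] at hz; linarith [hz.1]
  have hder : ∀ z ∈ uIcc 0 y, HasDerivWithinAt (fun y => log (1 + y) - y + y ^ 2 / 2)
      (z ^ 2 / (1 + z)) (uIcc 0 y) z := by
    intro z hz
    have hz' : (1 + z) ≠ 0 := by linarith [hpos z hz]
    have h1 : HasDerivAt (fun y : ℝ => log (1 + y) - y + y ^ 2 / 2)
        (1 / (1 + z) - 1 + (2 * z) / 2) z := by
      have hl : HasDerivAt (fun y : ℝ => log (1 + y)) (1 / (1 + z)) z :=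
        ((hasDerivAt_id z).const_add 1).log hz'
      have hp : HasDerivAt (fun y : ℝ => y ^ 2) (2 * z) z := by
        simpa using hasDerivAt_pow 2 z
      exact (hl.sub (hasDerivAt_id z)).add (hp.div_const 2)
    refine (h1.congr_deriv ?_).hasDerivWithinAt
    field_simp
    ring
  have hb : ∀ z ∈ uIcc 0 y, ‖z ^ 2 / (1 + z)‖ ≤ 2 * y ^ 2 := by
    intro z hz
    have h1 := hpos z hz
    have h2 : z ^ 2 ≤ y ^ 2 := by
      rw [sq_le_sq]
      have := abs_sub_left_of_mem_uIcc hz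
      simpa using this
    rw [Real.norm_of_nonneg (by positivity), div_le_iff₀ (by linarith)]
    nlinarith [sq_nonneg y]
  have := (convex_uIcc (0 : ℝ) y).norm_image_sub_le_of_norm_hasDerivWithin_le hder hb
    left_mem_uIcc right_mem_uIcc
  simp only [Real.norm_eq_abs] at this
  simpa [pow_succ, ← sq_abs y, mul_assoc] using this

/-- The Jensen gap of the logarithm, to third order. -/
lemma abs_log_integral_sub_integral_log_le {Ω : Type*} [MeasurableSpace Ω] {P : Measure Ω}
    [IsProbabilityMeasure P] {X y Ψ : Ω → ℝ} {C K s : ℝ} (hs : 0 ≤ s) (hs1 : s ≤ 1) (hC : 0 ≤ C)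
    (hXm : AEStronglyMeasurable X P) (hym : AEStronglyMeasurable y P)
    (hΨm : AEStronglyMeasurable Ψ P) (hΨ1 : ∀ᵐ x ∂P, 1 ≤ Ψ x)
    (hΨ : Integrable (fun x => Ψ x ^ 3) P) (hK : ∫ x, Ψ x ^ 3 ∂P ≤ K)
    (hX : ∀ᵐ x ∂P, |X x| ≤ C * s * Ψ x) (hyX : ∀ᵐ x ∂P, |y x - X x| ≤ C * s ^ 2 * Ψ x)
    (hy : ∀ᵐ x ∂P, -(1 / 2) ≤ y x) :
    Integrable y P ∧ Integrable (fun x => log (1 + y x)) P ∧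
    |log (1 + ∫ x, y x ∂P) - ∫ x, log (1 + y x) ∂P -
      (∫ x, (X x - ∫ x', X x' ∂P) ^ 2 ∂P) / 2| ≤
      (16 * C ^ 3 * K + 16 * C ^ 3 * K ^ 3 + 3 * C ^ 2 * K + 3 * C ^ 2 * K ^ 2) * s ^ 3 := by
  have hle1 : ∀ᵐ x ∂P, Ψ x ≤ Ψ x ^ 3 := by
    filter_upwards [hΨ1] with x h
    exact le_self_pow₀ h (by norm_num)
  have hle2 : ∀ᵐ x ∂P, Ψ x ^ 2 ≤ Ψ x ^ 3 := by
    filter_upwards [hΨ1] with x h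
    exact pow_le_pow_right₀ h (by norm_num)
  have hΨi : Integrable Ψ P := hΨ.mono' hΨm (by
    filter_upwards [hΨ1, hle1] with x h h'
    rwa [Real.norm_of_nonneg (by linarith)])
  have hΨi2 : Integrable (fun x => Ψ x ^ 2) P := hΨ.mono' (hΨm.pow 2) (by
    filter_upwards [hle2] with x h'
    rwa [Real.norm_of_nonneg (by positivity)])
  have hE1 : ∫ x, Ψ x ∂P ≤ K := (integral_mono_ae hΨi hΨ hle1).trans hK
  have hE2 : ∫ x, Ψ x ^ 2 ∂P ≤ K := (integral_mono_ae hΨi2 hΨ hle2).trans hK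
  have hK0 : 0 ≤ K := le_trans (integral_nonneg_of_ae (by
    filter_upwards [hΨ1] with x h
    exact zero_le_one.trans h)) hE1
  have hs2 : s ^ 2 ≤ s := by nlinarith
  have hyb : ∀ᵐ x ∂P, |y x| ≤ 2 * C * s * Ψ x := by
    filter_upwards [hX, hyX, hΨ1] with x h1 h2 h3
    have h4 : C * s ^ 2 * Ψ x ≤ C * s * Ψ x := by
      have : 0 ≤ Ψ x := by linarith
      gcongr
    have h5 : |y x| ≤ |y x - X x| + |X x| := by
      simpa using abs_add_le (y x - X x) (X x)
    linarith
  -- Every error term below is dominated by a constant times `Ψ`, `Ψ²` or `Ψ³`; since `Ψ ≥ 1`, the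
  -- bound `K` on the third moment serves for all three.
  have bound : ∀ {f g : Ω → ℝ} {k B : ℝ}, 0 ≤ k → AEStronglyMeasurable f P → Integrable g P →
      ∫ x, g x ∂P ≤ B → (∀ᵐ x ∂P, |f x| ≤ k * g x) →
      Integrable f P ∧ |∫ x, f x ∂P| ≤ k * B := by
    intro f g k B hk hf hg hB hfg
    refine ⟨(hg.const_mul k).mono' hf (by simpa only [Real.norm_eq_abs] using hfg), ?_⟩
    have := norm_integral_le_of_norm_le (f := f) (hg.const_mul k)
      (by simpa only [Real.norm_eq_abs] using hfg)
    rw [integral_const_mul, Real.norm_eq_abs] at this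
    exact this.trans (by gcongr)
  obtain ⟨hXi, hXe⟩ := bound (by positivity) hXm hΨi hE1 hX
  obtain ⟨hyi, hye⟩ := bound (by positivity) hym hΨi hE1 hyb
  obtain ⟨hdi, hde⟩ := bound (by positivity) (hym.sub hXm) hΨi hE1 hyX
  obtain ⟨hX2i, -⟩ := bound (f := fun x => X x ^ 2) (k := (C * s) ^ 2)
    (by positivity) (hXm.pow 2) hΨi2 hE2 (by
    filter_upwards [hX] with x h
    rw [abs_pow, ← mul_pow]
    gcongr)
  obtain ⟨hy2i, -⟩ := bound (f := fun x => y x ^ 2) (k := (2 * C * s) ^ 2)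
    (by positivity) (hym.pow 2) hΨi2 hE2 (by
    filter_upwards [hyb] with x h
    rw [abs_pow, ← mul_pow]
    gcongr)
  have hlm : AEStronglyMeasurable (fun x => log (1 + y x)) P :=
    (Real.measurable_log.comp_aemeasurable (hym.aemeasurable.const_add 1)).aestronglyMeasurable
  obtain ⟨hri, hre⟩ := bound (f := fun x => log (1 + y x) - y x + y x ^ 2 / 2)
    (k := 2 * (2 * C * s) ^ 3) (by positivity) ((hlm.sub hym).add (hy2i.div_const 2).1) hΨ hK (by
    filter_upwards [hyb, hy] with x h h'
    refine (abs_log_one_add_sub_le h').trans ?_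
    rw [mul_assoc, ← mul_pow]
    gcongr)
  obtain ⟨hqi, hqe⟩ := bound (f := fun x => y x ^ 2 - X x ^ 2)
    (k := 3 * C ^ 2 * s ^ 3) (by positivity) ((hym.pow 2).sub (hXm.pow 2)) hΨi2 hE2 (by
    filter_upwards [hX, hyX, hyb, hΨ1] with x h1 h2 h3 h4
    have h5 : |y x + X x| ≤ 3 * C * s * Ψ x := (abs_add_le _ _).trans (by linarith)
    have : y x ^ 2 - X x ^ 2 = (y x - X x) * (y x + X x) := by ring
    rw [this, abs_mul]
    calc _ ≤ (C * s ^ 2 * Ψ x) * (3 * C * s * Ψ x) := by gcongr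
      _ = _ := by ring)
  have hlogi : Integrable (fun x => log (1 + y x)) P := by
    have := (hri.add hyi).sub (hy2i.div_const 2)
    refine this.congr (ae_of_all _ fun x => ?_)
    simp only [Pi.sub_apply, Pi.add_apply]
    ring
  refine ⟨hyi, hlogi, ?_⟩
  have hEy : -(1 / 2) ≤ ∫ x, y x ∂P := by
    have := integral_mono_ae (integrable_const (-(1 / 2) : ℝ)) hyi hy
    simpa using this
  have hl := abs_log_one_add_sub_le hEy
  have hl' : 2 * |∫ x, y x ∂P| ^ 3 ≤ 2 * (2 * C * s * K) ^ 3 := by gcongr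
  have hr_eq : ∫ x, (log (1 + y x) - y x + y x ^ 2 / 2) ∂P =
      ∫ x, log (1 + y x) ∂P - ∫ x, y x ∂P + (∫ x, y x ^ 2 ∂P) / 2 := by
    have hi : Integrable (fun x => log (1 + y x) - y x) P := hlogi.sub hyi
    rw [integral_add hi (hy2i.div_const 2), integral_sub hlogi hyi, integral_div]
  have hq_eq : ∫ x, (y x ^ 2 - X x ^ 2) ∂P = ∫ x, y x ^ 2 ∂P - ∫ x, X x ^ 2 ∂P :=
    integral_sub hy2i hX2i
  have hd_eq : ∫ x, (y - X) x ∂P = ∫ x, y x ∂P - ∫ x, X x ∂P := integral_sub' hyi hXi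
  have hvar : ∫ x, (X x - ∫ x', X x' ∂P) ^ 2 ∂P = ∫ x, X x ^ 2 ∂P - (∫ x, X x ∂P) ^ 2 := by
    set e := ∫ x, X x ∂P with he
    have : (fun x => (X x - e) ^ 2) = fun x => X x ^ 2 - 2 * e * X x + e ^ 2 := by
      funext x; ring
    have hi : Integrable (fun x => X x ^ 2 - 2 * e * X x) P := hX2i.sub (hXi.const_mul _)
    rw [this, integral_add hi (integrable_const _), integral_sub hX2i (hXi.const_mul _),
      integral_const_mul, ← he]
    simp
    ring
  rw [hr_eq] at hre
  rw [hq_eq] at hqe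
  rw [hd_eq] at hde
  rw [hvar]
  set ey := ∫ x, y x ∂P
  set ex := ∫ x, X x ∂P
  set ey2 := ∫ x, y x ^ 2 ∂P
  set ex2 := ∫ x, X x ^ 2 ∂P
  set el := ∫ x, log (1 + y x) ∂P
  have hsq : |ey ^ 2 - ex ^ 2| ≤ 3 * C ^ 2 * K ^ 2 * s ^ 3 := by
    have : ey ^ 2 - ex ^ 2 = (ey - ex) * (ey + ex) := by ring
    have h5 : |ey + ex| ≤ 3 * C * s * K := (abs_add_le _ _).trans (by linarith)
    rw [this, abs_mul]
    calc _ ≤ (C * s ^ 2 * K) * (3 * C * s * K) := by gcongr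
      _ = _ := by ring
  -- The four error sources are the logarithmic remainder at the mean, its expectation, the exchange
  -- of `E y²` for `E X²`, and that of `(E y)²` for `(E X)²`. The first-order terms `E y` cancel.
  have hfin := hl.trans hl'
  rw [abs_le] at *
  have e1 : 2 * (2 * C * s * K) ^ 3 = 16 * C ^ 3 * K ^ 3 * s ^ 3 := by ring
  have e2 : 2 * (2 * C * s) ^ 3 * K = 16 * C ^ 3 * K * s ^ 3 := by ring
  have e3 : 3 * C ^ 2 * s ^ 3 * K = 3 * C ^ 2 * K * s ^ 3 := by ring
  have n1 : 0 ≤ 3 * C ^ 2 * K * s ^ 3 := by positivity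
  have n2 : 0 ≤ 3 * C ^ 2 * K ^ 2 * s ^ 3 := by positivity
  rw [e1] at hfin
  rw [e2] at hre
  rw [e3] at hqe
  constructor <;> linarith [hfin.1, hfin.2, hre.1, hre.2, hqe.1, hqe.2, hsq.1, hsq.2]

/-- Relative entropy with respect to a reweighted probability measure. -/
lemma klDiv_withDensity_right {Ω : Type*} [MeasurableSpace Ω] {P : Measure Ω}
    [IsProbabilityMeasure P] {h : Ω → ℝ} (hh : ∀ x, 0 < h x) (hi : Integrable h P)
    (hl : Integrable (fun x => log (h x)) P) :
    IsProbabilityMeasure (P.withDensity fun x => ENNReal.ofReal (h x / ∫ x', h x' ∂P)) ∧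
    InformationTheory.klDiv P
      (P.withDensity fun x => ENNReal.ofReal (h x / ∫ x', h x' ∂P)) ≠ ⊤ ∧
    (InformationTheory.klDiv P
      (P.withDensity fun x => ENNReal.ofReal (h x / ∫ x', h x' ∂P))).toReal =
      log (∫ x, h x ∂P) - ∫ x, log (h x) ∂P := by
  have hE : 0 < ∫ x, h x ∂P := by
    rw [integral_pos_iff_support_of_nonneg (fun x => (hh x).le) hi]
    have : Function.support h = univ := by
      ext x; simp [(hh x).ne']
    simp [this]
  set e := ∫ x, h x ∂P with he
  set f : Ω → ENNReal := fun x => ENNReal.ofReal (h x / e) with hf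
  have hfm : AEMeasurable f P := (hi.aemeasurable.div_const e).ennreal_ofReal
  have hprob : IsProbabilityMeasure (P.withDensity f) := by
    constructor
    rw [withDensity_apply _ MeasurableSet.univ, Measure.restrict_univ,
      ← ofReal_integral_eq_lintegral_ofReal (hi.div_const e)
        (ae_of_all _ fun x => (div_pos (hh x) hE).le), integral_div, ← he, div_self hE.ne',
      ENNReal.ofReal_one]
  have hf0 : ∀ᵐ x ∂P, f x ≠ 0 := ae_of_all _ fun x => by
    simp only [hf, ne_eq, ENNReal.ofReal_eq_zero, not_le]
    exact div_pos (hh x) hE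
  have hac : P ≪ P.withDensity f := withDensity_absolutelyContinuous' hfm hf0
  have hllr : llr P (P.withDensity f) =ᵐ[P] fun x => log e - log (h x) := by
    have h1 := Measure.rnDeriv_withDensity_right P P hfm hf0
      (ae_of_all _ fun x => ENNReal.ofReal_ne_top)
    filter_upwards [h1, Measure.rnDeriv_self P] with x h2 h3
    rw [llr, h2, h3, mul_one, ENNReal.toReal_inv, Real.log_inv,
      ENNReal.toReal_ofReal (div_pos (hh x) hE).le, Real.log_div (hh x).ne' hE.ne']
    ring
  have h_int : Integrable (llr P (P.withDensity f)) P :=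
    ((integrable_const (log e)).sub hl).congr hllr.symm
  refine ⟨hprob, InformationTheory.klDiv_ne_top hac h_int, ?_⟩
  -- Both measures have mass one, so the mass correction in `klDiv` vanishes and the mean
  -- log-likelihood ratio remains.
  rw [InformationTheory.toReal_klDiv_of_measure_eq hac (by simp), integral_congr_ae hllr,
    integral_sub (integrable_const _) hl]
  simp

/-! ### Uniform exponential moments of the natural parameter under the posteriors. -/

section

/-- Exponential tilting by `-n V` keeps the exponential moment `exp (N V)` bounded, uniformly in
`n ≥ N`. -/
lemma exists_tilted_moment_bound {Ω : Type*} [MeasurableSpace Ω] {μ : Measure Ω} {p V : Ω → ℝ}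
    (hp : Integrable p μ) (hp0 : ∀ x, 0 ≤ p x) (hV : AEStronglyMeasurable V μ)
    (hV0 : ∀ᵐ x ∂μ, 0 ≤ V x) {U : Set Ω} (hU : MeasurableSet U) (hU1 : ∀ x ∈ U, V x ≤ 1)
    (hpU : 0 < ∫ x in U, p x ∂μ) (N : ℕ) :
    ∃ K : ℝ, ∀ n : ℕ, N ≤ n → Integrable (fun x => exp (-(n * V x)) * p x) μ ∧
      0 < ∫ x, exp (-(n * V x)) * p x ∂μ ∧
      Integrable (fun x => exp (N * V x) * (exp (-(n * V x)) * p x)) μ ∧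
      ∫ x, exp (N * V x) * (exp (-(n * V x)) * p x) ∂μ ≤
        K * ∫ x, exp (-(n * V x)) * p x ∂μ := by
  have hexp : ∀ c : ℝ, AEStronglyMeasurable (fun x => exp (c * V x)) μ := fun c =>
    Real.continuous_exp.comp_aestronglyMeasurable (hV.const_mul c)
  set m₀ := ∫ x, p x ∂μ with hm₀
  set m₁ := ∫ x in U, p x ∂μ with hm₁
  have hm₀0 : 0 ≤ m₀ := integral_nonneg hp0
  refine ⟨exp N * (m₀ / m₁) + exp N, fun n hn => ?_⟩
  have hnN : (N : ℝ) ≤ n := by exact_mod_cast hn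
  have hn0 : (0 : ℝ) ≤ n := Nat.cast_nonneg n
  have hi1 : Integrable (fun x => exp (-(n * V x)) * p x) μ := by
    refine hp.mono' ((by simpa using hexp (-n) : AEStronglyMeasurable _ μ).mul hp.1) ?_
    filter_upwards [hV0] with x hx
    rw [Real.norm_of_nonneg (mul_nonneg (exp_pos _).le (hp0 x))]
    refine mul_le_of_le_one_left (hp0 x) (Real.exp_le_one_iff.2 ?_)
    have := mul_nonneg hn0 hx
    linarith
  have hi2 : Integrable (fun x => exp (N * V x) * (exp (-(n * V x)) * p x)) μ := by
    refine hp.mono' ((hexp N).mul hi1.1) ?_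
    filter_upwards [hV0] with x hx
    rw [← mul_assoc, ← Real.exp_add,
      Real.norm_of_nonneg (mul_nonneg (exp_pos _).le (hp0 x))]
    refine mul_le_of_le_one_left (hp0 x) (Real.exp_le_one_iff.2 ?_)
    have := mul_le_mul_of_nonneg_right hnN hx
    linarith
  -- On `U` the tilt is at least `exp (-n)`, so the normalising integral cannot be smaller than this
  -- order.
  have hlow : exp (-n) * m₁ ≤ ∫ x, exp (-(n * V x)) * p x ∂μ := by
    rw [hm₁, ← integral_const_mul]
    refine le_trans (setIntegral_mono_on (hp.const_mul _).integrableOn hi1.integrableOn hU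
      fun x hx => ?_) (setIntegral_le_integral hi1 (ae_of_all _ fun x =>
        mul_nonneg (exp_pos _).le (hp0 x)))
    have := mul_le_mul_of_nonneg_left (hU1 x hx) hn0
    have h2 := hp0 x
    gcongr
    linarith
  have hpos : 0 < ∫ x, exp (-(n * V x)) * p x ∂μ :=
    lt_of_lt_of_le (mul_pos (exp_pos _) hpU) hlow
  refine ⟨hi1, hpos, hi2, ?_⟩
  -- Where `V ≥ 1`, `(N - n) V ≤ N - n` gives the first summand, of order `exp (-n)` and hence
  -- comparable to the normalising integral by `hlow`. Where `V ≤ 1`, `exp (N V) ≤ exp N` gives the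
  -- second.
  have hup : ∫ x, exp (N * V x) * (exp (-(n * V x)) * p x) ∂μ ≤
      ∫ x, (exp N * exp (-n) * p x + exp N * (exp (-(n * V x)) * p x)) ∂μ := by
    refine integral_mono_ae hi2 ((hp.const_mul _).add (hi1.const_mul _)) ?_
    filter_upwards [hV0] with x hx
    rcases le_total 1 (V x) with h | h
    · have h1 : exp (N * V x) * (exp (-(n * V x)) * p x) ≤ exp N * exp (-n) * p x := by
        rw [← mul_assoc, ← Real.exp_add, ← Real.exp_add]
        refine mul_le_mul_of_nonneg_right (Real.exp_le_exp.2 ?_) (hp0 x)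
        nlinarith
      have h2 : 0 ≤ exp N * (exp (-(n * V x)) * p x) := by
        have := hp0 x
        positivity
      linarith
    · have h1 : exp (N * V x) * (exp (-(n * V x)) * p x) ≤
          exp N * (exp (-(n * V x)) * p x) := by
        have := hp0 x
        gcongr
        exact mul_le_of_le_one_right (Nat.cast_nonneg N) h
      have h2 : 0 ≤ exp N * exp (-n) * p x := by
        have := hp0 x
        positivity
      linarith
  rw [integral_add (hp.const_mul _) (hi1.const_mul _), integral_const_mul, integral_const_mul]
    at hup
  refine hup.trans ?_
  rw [add_mul]
  refine add_le_add ?_ le_rfl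
  rw [← hm₀]
  have : exp (-n) ≤ (∫ x, exp (-(n * V x)) * p x ∂μ) / m₁ := (le_div_iff₀ hpU).2 hlow
  calc exp N * exp (-n) * m₀ ≤ exp N * ((∫ x, exp (-(n * V x)) * p x ∂μ) / m₁) * m₀ := by gcongr
    _ = _ := by ring

variable {d m q : ℕ} {F : ExpFamily d m q}

lemma ExpFamily.isProbabilityMeasure_sampleLaw {θ : EuclideanSpace ℝ (Fin m)} (hθ : θ ∈ F.Θ) :
    IsProbabilityMeasure (F.sampleLaw θ) := by
  constructor
  rw [ExpFamily.sampleLaw, withDensity_apply _ MeasurableSet.univ, Measure.restrict_univ]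
  exact F.normalized θ hθ

/-- The density of the sufficient statistic has total mass one. -/
lemma ExpFamily.IsStatCarrier.lintegral_eq_one {n : ℕ} {Rn : EuclideanSpace ℝ (Fin q) → ℝ}
    (h : F.IsStatCarrier n Rn) {θ : EuclideanSpace ℝ (Fin m)} (hθ : θ ∈ F.Θ) :
    ∫⁻ y, ENNReal.ofReal (Rn y * Real.exp (∑ i, F.η θ i * y i - n * F.A θ)) = 1 := by
  have := ExpFamily.isProbabilityMeasure_sampleLaw hθ
  have hm : Measurable fun x : Fin n → EuclideanSpace ℝ (Fin d) => ∑ j, F.S (x j) :=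
    Finset.measurable_sum _ fun j _ => F.measurable_S.comp (measurable_pi_apply j)
  have h1 := congrArg (fun μ : Measure (EuclideanSpace ℝ (Fin q)) => μ univ) (h.law θ hθ)
  simp only [withDensity_apply _ MeasurableSet.univ, Measure.restrict_univ,
    Measure.map_apply hm MeasurableSet.univ, preimage_univ, measure_univ] at h1
  exact h1.symm

/-- On `Θ` the natural parameter grows at most linearly in `-g`. -/
lemma ExpFamily.IsStatCarrier.exists_norm_eta_le {n : ℕ} {Rn : EuclideanSpace ℝ (Fin q) → ℝ}
    (h : F.IsStatCarrier n Rn) {τs : EuclideanSpace ℝ (Fin q)} {r : ℝ} (hr : 0 < r)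
    (hcont : ContinuousOn Rn (Metric.ball ((n : ℝ) • τs) r))
    (hpos : ∀ y ∈ Metric.ball ((n : ℝ) • τs) r, 0 < Rn y) :
    ∃ c : ℝ, 0 < c ∧ ∃ K : ℝ, ∀ θ ∈ F.Θ, c * ‖F.η θ‖ ≤ K - n * F.g τs θ := by
  set y₀ := (n : ℝ) • τs with hy₀
  have hsub : Metric.closedBall y₀ (r / 2) ⊆ Metric.ball y₀ r :=
    Metric.closedBall_subset_ball (by linarith)
  obtain ⟨z, hz, hmin⟩ := (isCompact_closedBall y₀ (r / 2)).exists_isMinOn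
    ⟨y₀, Metric.mem_closedBall_self (by positivity)⟩ (hcont.mono hsub)
  have hRz : 0 < Rn z := hpos z (hsub hz)
  set vol₀ := volume.real (Metric.closedBall (0 : EuclideanSpace ℝ (Fin q)) (r / 8)) with hvol
  have hv0 : volume (Metric.closedBall (0 : EuclideanSpace ℝ (Fin q)) (r / 8)) ≠ 0 :=
    (Metric.measure_closedBall_pos volume _ (by positivity)).ne'
  have hvt : volume (Metric.closedBall (0 : EuclideanSpace ℝ (Fin q)) (r / 8)) ≠ ⊤ :=
    measure_closedBall_lt_top.ne
  have hvpos : 0 < vol₀ := ENNReal.toReal_pos hv0 hvt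
  refine ⟨r / 8, by positivity, -Real.log (Rn z * vol₀), fun θ hθ => ?_⟩
  set t := F.η θ with ht
  -- A displacement of length `r / 4` in the direction of `η(θ)`. On the ball of radius `r / 8`
  -- about the displaced centre, `η·y` exceeds `n η·τ*` by at least `(r/8)‖η‖`, and the ball stays
  -- within distance `r / 2`, where `Rn` is at least `Rn z`. Total mass one then bounds the
  -- exponential. For `η = 0` the quotient makes `w = 0`.
  let w : EuclideanSpace ℝ (Fin q) := (r / 4 / ‖t‖) • t
  have hw : ‖w‖ ≤ r / 4 := by
    rw [norm_smul, Real.norm_of_nonneg (by positivity)]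
    rcases eq_or_ne ‖t‖ 0 with h0 | h0
    · rw [h0, mul_zero]
      positivity
    · rw [div_mul_cancel₀ _ h0]
  have hwt : inner ℝ t w = r / 4 * ‖t‖ := by
    rw [inner_smul_right, real_inner_self_eq_norm_sq]
    rcases eq_or_ne ‖t‖ 0 with h0 | h0
    · simp [h0]
    · field_simp
  have hsum : ∀ y : EuclideanSpace ℝ (Fin q), ∑ i, t i * y i = inner ℝ t y := by
    intro y
    simp [PiLp.inner_apply, mul_comm]
  have hpt : ∀ y ∈ Metric.closedBall (y₀ + w) (r / 8),
      Rn z * exp (n * F.g τs θ + r / 8 * ‖t‖) ≤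
        Rn y * exp (∑ i, t i * y i - n * F.A θ) := by
    intro y hy
    rw [mem_closedBall_iff_norm] at hy
    have hyb : y ∈ Metric.closedBall y₀ (r / 2) := by
      rw [mem_closedBall_iff_norm]
      have : y - y₀ = (y - (y₀ + w)) + w := by abel
      rw [this]
      refine (norm_add_le _ _).trans ?_
      linarith
    have h1 : Rn z ≤ Rn y := hmin hyb
    have h2 : n * F.g τs θ + r / 8 * ‖t‖ ≤ ∑ i, t i * y i - n * F.A θ := by
      have e1 : ∑ i, t i * y i = n * ∑ i, t i * τs i + inner ℝ t w +
          inner ℝ t (y - (y₀ + w)) := by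
        rw [hsum, hsum, inner_sub_right, inner_add_right, hy₀, real_inner_smul_right t τs]
        ring
      have e2 : -(‖t‖ * (r / 8)) ≤ inner ℝ t (y - (y₀ + w)) := by
        have := (abs_le.1 (abs_real_inner_le_norm t (y - (y₀ + w)))).1
        have h3 : ‖t‖ * ‖y - (y₀ + w)‖ ≤ ‖t‖ * (r / 8) := by gcongr
        linarith
      rw [e1, hwt, ExpFamily.g, ← ht]
      linarith
    gcongr
    exact hRz.le.trans h1
  have h_int : ENNReal.ofReal (Rn z * exp (n * F.g τs θ + r / 8 * ‖t‖)) *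
      volume (Metric.closedBall (y₀ + w) (r / 8)) ≤ 1 := by
    rw [← h.lintegral_eq_one hθ, ← setLIntegral_const]
    refine le_trans (setLIntegral_mono' Metric.isClosed_closedBall.measurableSet fun y hy =>
      ENNReal.ofReal_le_ofReal (hpt y hy)) (setLIntegral_le_lintegral _ _)
  rw [Measure.addHaar_closedBall_center] at h_int
  have hreal : Rn z * exp (n * F.g τs θ + r / 8 * ‖t‖) * vol₀ ≤ 1 := by
    have := ENNReal.toReal_mono ENNReal.one_ne_top h_int
    rwa [ENNReal.toReal_mul, ENNReal.toReal_ofReal (by positivity), ENNReal.toReal_one] at this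
  have hlog := Real.log_nonpos (by positivity) hreal
  have e : Rn z * exp (n * F.g τs θ + r / 8 * ‖t‖) * vol₀ =
      (Rn z * vol₀) * exp (n * F.g τs θ + r / 8 * ‖t‖) := by ring
  rw [e, Real.log_mul (by positivity) (by positivity), Real.log_exp] at hlog
  linarith

end

section

section Normalized

variable {Ω : Type*} [MeasurableSpace Ω] {μ : Measure Ω} {w : Ω → ℝ}

/-- The posterior has exactly this shape, with `w` the joint density at `τ*` and `μ` Lebesgue
measure on `Θ`; this lemma and the next two translate statements under the posterior into weighted
integrals. -/
lemma isProbabilityMeasure_normalized (hw : Integrable w μ) (hw0 : ∀ x, 0 ≤ w x)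
    (hpos : 0 < ∫ x, w x ∂μ) :
    IsProbabilityMeasure (μ.withDensity fun x => ENNReal.ofReal (w x / ∫ x', w x' ∂μ)) := by
  constructor
  rw [withDensity_apply _ MeasurableSet.univ, Measure.restrict_univ,
    ← ofReal_integral_eq_lintegral_ofReal (hw.div_const _)
      (ae_of_all _ fun x => div_nonneg (hw0 x) hpos.le), integral_div, div_self hpos.ne',
    ENNReal.ofReal_one]

lemma integrable_normalized_iff (hw : Integrable w μ) (hw0 : ∀ x, 0 ≤ w x)
    (hpos : 0 < ∫ x, w x ∂μ) (φ : Ω → ℝ) :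
    Integrable φ (μ.withDensity fun x => ENNReal.ofReal (w x / ∫ x', w x' ∂μ)) ↔
      Integrable (fun x => φ x * w x) μ := by
  rw [integrable_withDensity_iff_integrable_smul₀' (hw.aemeasurable.div_const _).ennreal_ofReal
    (ae_of_all _ fun x => ENNReal.ofReal_lt_top)]
  have : (fun x => (ENNReal.ofReal (w x / ∫ x', w x' ∂μ)).toReal • φ x) =
      fun x => (∫ x', w x' ∂μ)⁻¹ * (φ x * w x) := by
    funext x
    rw [ENNReal.toReal_ofReal (div_nonneg (hw0 x) hpos.le), smul_eq_mul]
    ring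
  rw [this, integrable_const_mul_iff (by simpa using hpos.ne')]

lemma integral_normalized (hw : Integrable w μ) (hw0 : ∀ x, 0 ≤ w x)
    (hpos : 0 < ∫ x, w x ∂μ) (φ : Ω → ℝ) :
    ∫ x, φ x ∂(μ.withDensity fun x => ENNReal.ofReal (w x / ∫ x', w x' ∂μ)) =
      (∫ x, φ x * w x ∂μ) / ∫ x, w x ∂μ := by
  rw [integral_withDensity_eq_integral_toReal_smul₀ (hw.aemeasurable.div_const _).ennreal_ofReal
    (ae_of_all _ fun x => ENNReal.ofReal_lt_top), ← integral_div]
  congr 1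
  funext x
  rw [ENNReal.toReal_ofReal (div_nonneg (hw0 x) hpos.le), smul_eq_mul]
  ring

end Normalized

variable {d m q : ℕ} {F : ExpFamily d m q}

lemma ExpFamily.jointDensity_nonneg {ρ : EuclideanSpace ℝ (Fin q)} {κ : ℝ} {n : ℕ}
    {Rn : EuclideanSpace ℝ (Fin q) → ℝ} (hR : ∀ y, 0 ≤ Rn y) (τ : EuclideanSpace ℝ (Fin q))
    (θ : EuclideanSpace ℝ (Fin m)) : 0 ≤ F.jointDensity ρ κ n Rn τ θ := by
  have h1 : 0 ≤ F.Z ρ κ := inv_nonneg.2 (integral_nonneg fun θ => (exp_pos _).le)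
  have h2 := hR ((n : ℝ) • τ)
  unfold jointDensity statDensity priorDensity priorWeight
  positivity

/-- The posteriors have a common exponential moment of the natural parameter. -/
lemma ExpFamily.exists_posterior_moment_bound {ρ : EuclideanSpace ℝ (Fin q)} {κ : ℝ}
    (hprior : IntegrableOn (F.priorWeight ρ κ) F.Θ)
    {R : ℕ → EuclideanSpace ℝ (Fin q) → ℝ} {N : ℕ} (hN : 1 ≤ N)
    (hR : ∀ n ≥ N, F.IsStatCarrier n (R n)) {τs : EuclideanSpace ℝ (Fin q)}
    (hreg : F.Regular R N τs) (hmax : F.UniqueNondegMax τs) :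
    ∃ c : ℝ, 0 < c ∧ ∃ K : ℝ, ∀ n ≥ N,
      IntegrableOn (F.jointDensity ρ κ n (R n) τs) F.Θ ∧
      0 < F.marginal ρ κ n (R n) τs ∧
      Integrable (fun θ => exp (c * ‖F.η θ‖)) (F.posterior ρ κ n (R n) τs) ∧
      ∫ θ, exp (c * ‖F.η θ‖) ∂F.posterior ρ κ n (R n) τs ≤ K := by
  obtain ⟨r, hr, hRr⟩ := hreg.smooth_R
  obtain ⟨hg, θs, hθs, hlt, -, -⟩ := hmax
  -- Used at the single sample size `N`, so that `c` and `K₀` do not depend on `n`.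
  obtain ⟨c, hc, K₀, hη⟩ := (hR N le_rfl).exists_norm_eta_le hr (hRr N le_rfl).1.continuousOn
    (hRr N le_rfl).2
  set gs := F.g τs θs with hgs
  set V : EuclideanSpace ℝ (Fin m) → ℝ := fun θ => gs - F.g τs θ with hV
  set p := F.priorWeight ρ κ with hp
  have hp0 : ∀ θ, 0 < p θ := fun θ => exp_pos _
  have hVcont : ContinuousOn V F.Θ := continuousOn_const.sub hg.continuousOn
  have hV0 : ∀ θ ∈ F.Θ, 0 ≤ V θ := by
    intro θ hθ
    rcases eq_or_ne θ θs with rfl | hne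
    · simp [hV, hgs]
    · exact (sub_pos.2 (hlt θ hθ hne)).le
  have hnhds : F.Θ ∈ nhds θs := mem_interior_iff_mem_nhds.1 hθs
  have hVat : ∀ᶠ θ in nhds θs, V θ < 1 := by
    have h1 : V θs = 0 := by simp [hV, hgs]
    exact (hVcont.continuousAt hnhds).eventually (gt_mem_nhds (by rw [h1]; exact one_pos))
  obtain ⟨s, hs, hball⟩ := Metric.mem_nhds_iff.1 (Filter.inter_mem hnhds hVat)
  -- The maximiser is interior, so a whole ball on which `V < 1` lies in `Θ`, and the strictly
  -- positive prior weight gives it positive mass.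
  have hpU : 0 < ∫ θ in Metric.ball θs s, p θ ∂(volume.restrict F.Θ) := by
    have hsub : Metric.ball θs s ⊆ F.Θ := fun θ h => (hball h).1
    rw [integral_pos_iff_support_of_nonneg (fun θ => (hp0 θ).le)
      (show Integrable p (volume.restrict F.Θ) from hprior).restrict]
    have : Function.support p = univ := by
      ext θ; simp [(hp0 θ).ne']
    rw [this, Measure.restrict_apply_univ, Measure.restrict_apply measurableSet_ball,
      inter_eq_left.2 hsub]
    exact Metric.measure_ball_pos volume _ hs
  have hZ : 0 < F.Z ρ κ := by
    refine inv_pos.2 (hpU.trans_le ?_)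
    exact setIntegral_le_integral hprior (ae_of_all _ fun θ => (hp0 θ).le)
  obtain ⟨K, hK⟩ := exists_tilted_moment_bound hprior (fun θ => (hp0 θ).le)
    (hVcont.aestronglyMeasurable F.measurableSet_Θ)
    ((ae_restrict_mem F.measurableSet_Θ).mono hV0) measurableSet_ball
    (fun θ hθ => (hball hθ).2.le) hpU N
  refine ⟨c, hc, exp (K₀ - N * gs) * K, fun n hn => ?_⟩
  obtain ⟨hi, hpos, hi', hle⟩ := hK n hn
  have hn1 : 0 < n := by omega
  have hRn : 0 < R n ((n : ℝ) • τs) := (hRr n hn).2 _ (Metric.mem_ball_self hr)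
  set a := (n : ℝ) ^ q * R n ((n : ℝ) • τs) * exp (n * gs) * F.Z ρ κ with ha
  have ha0 : 0 < a := by positivity
  -- All dependence on `R_n(nτ*)` sits in the factor `a`, which cancels in the posterior.
  have hJ : F.jointDensity ρ κ n (R n) τs = fun θ => a * (exp (-(n * V θ)) * p θ) := by
    funext θ
    have : exp (n * ∑ i, F.η θ i * τs i - n * F.A θ) = exp (n * gs) * exp (-(n * V θ)) := by
      rw [← Real.exp_add]
      congr 1
      simp only [hV, ExpFamily.g]
      ring
    rw [jointDensity, statDensity, priorDensity, this, ha]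
    ring
  have hJi : IntegrableOn (F.jointDensity ρ κ n (R n) τs) F.Θ := by
    rw [hJ]
    exact hi.const_mul a
  have hmarg : F.marginal ρ κ n (R n) τs = a * ∫ θ in F.Θ, exp (-(n * V θ)) * p θ := by
    rw [marginal, hJ, integral_const_mul]
  have hmpos : 0 < F.marginal ρ κ n (R n) τs := by
    rw [hmarg]
    exact mul_pos ha0 hpos
  have hJ0 := F.jointDensity_nonneg (ρ := ρ) (κ := κ) (n := n) (hR n hn).nonneg τs
  have hηm : AEStronglyMeasurable F.η (volume.restrict F.Θ) :=
    hreg.smooth_η.continuousOn.aestronglyMeasurable F.measurableSet_Θ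
  have hbound : ∀ᵐ θ ∂volume.restrict F.Θ, exp (c * ‖F.η θ‖) * (exp (-(n * V θ)) * p θ) ≤
      exp (K₀ - N * gs) * (exp (N * V θ) * (exp (-(n * V θ)) * p θ)) := by
    filter_upwards [ae_restrict_mem F.measurableSet_Θ] with θ hθ
    rw [← mul_assoc (exp (K₀ - N * gs)), ← Real.exp_add]
    have h1 := hη θ hθ
    have h2 := (hp0 θ).le
    gcongr
    simp only [hV]
    linarith
  have hi'' : Integrable (fun θ => exp (c * ‖F.η θ‖) * (exp (-(n * V θ)) * p θ))
      (volume.restrict F.Θ) := by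
    refine (hi'.const_mul (exp (K₀ - N * gs))).mono'
      ((Real.continuous_exp.comp_aestronglyMeasurable (hηm.norm.const_mul c)).mul hi.1) ?_
    filter_upwards [hbound] with θ h
    have h2 := (hp0 θ).le
    rwa [Real.norm_of_nonneg (by positivity)]
  refine ⟨hJi, hmpos, ?_, ?_⟩
  · refine (integrable_normalized_iff hJi hJ0 hmpos _).2 ?_
    rw [hJ]
    refine (hi''.const_mul a).congr (ae_of_all _ fun θ => ?_)
    simp only
    ring
  · refine (integral_normalized hJi hJ0 hmpos _).trans_le ?_
    change _ / F.marginal ρ κ n (R n) τs ≤ _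
    rw [div_le_iff₀ hmpos, hmarg]
    have h1 : ∫ θ in F.Θ, exp (c * ‖F.η θ‖) * F.jointDensity ρ κ n (R n) τs θ =
        a * ∫ θ in F.Θ, exp (c * ‖F.η θ‖) * (exp (-(n * V θ)) * p θ) := by
      rw [← integral_const_mul, hJ]
      congr 1
      funext θ
      ring
    rw [h1]
    have h2 := integral_mono_ae hi'' (hi'.const_mul _) hbound
    rw [integral_const_mul] at h2
    calc _ ≤ a * (exp (K₀ - N * gs) * (K * ∫ θ in F.Θ, exp (-(n * V θ)) * p θ)) := by
          gcongr
          exact h2.trans (by gcongr)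
      _ = _ := by ring

end

/-! ### Expansion of the averaged likelihood ratio. -/

lemma abs_exp_sub_cubic_le (x : ℝ) :
    |exp x - (1 + x + x ^ 2 / 2 + x ^ 3 / 6)| ≤ |x| ^ 4 * exp |x| := by
  have h := Complex.norm_exp_sub_sum_le_norm_mul_exp (x : ℂ) 4
  have e : Complex.exp x - ∑ m ∈ Finset.range 4, (x : ℂ) ^ m / (m.factorial : ℂ) =
      ((exp x - (1 + x + x ^ 2 / 2 + x ^ 3 / 6) : ℝ) : ℂ) := by
    simp [Finset.sum_range_succ, Nat.factorial]
  rw [e, Complex.norm_real, Complex.norm_real] at h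
  exact h

/-- Averaging the cubic expansions of the exponential at `x` and `-x` removes the odd terms. -/
lemma abs_cosh_sub_le (x : ℝ) : |cosh x - 1 - x ^ 2 / 2| ≤ |x| ^ 4 * exp |x| := by
  have h1 := abs_le.1 (abs_exp_sub_cubic_le x)
  have h2 := abs_le.1 (abs_exp_sub_cubic_le (-x))
  rw [abs_neg] at h2
  rw [Real.cosh_eq, abs_le]
  constructor <;> nlinarith [h1.1, h1.2, h2.1, h2.2]

/-- Here `b` (of size `α²`) stands for the even part of the exponent, `s` (of size `α`) for the odd
part, and `l` for its linearisation. The discarded terms `b²`, `b s²`, `s⁴` and `s² - l²` are all of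
order `α⁴`; there is no cubic term. The steps give the constant 6, rounded up to 7. -/
lemma abs_exp_mul_cosh_sub_le {α Λ M b s l : ℝ} (hα : 0 ≤ α) (hΛ : 1 ≤ Λ)
    (hMΛ : M ≤ Λ) (hMα : M * α ^ 2 ≤ 1) (hb : |b| ≤ M * α ^ 2)
    (hl : |l| ≤ Λ * α) (hs : |s| ≤ Λ * α) (hsl : |s - l| ≤ M * α ^ 3) :
    |exp b * cosh s - 1 - b - l ^ 2 / 2| ≤ 7 * α ^ 4 * (Λ ^ 4 * exp (α * Λ)) := by
  have hb1 : |b| ≤ 1 := hb.trans hMα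
  have hbΛ : |b| ≤ Λ * α ^ 2 := hb.trans (by gcongr)
  have hE : 1 ≤ exp (α * Λ) := Real.one_le_exp (by positivity)
  have hΛ2 : Λ ^ 2 ≤ Λ ^ 4 := pow_le_pow_right₀ hΛ (by norm_num)
  have hΛ3 : Λ ^ 3 ≤ Λ ^ 4 := pow_le_pow_right₀ hΛ (by norm_num)
  set T := α ^ 4 * (Λ ^ 4 * exp (α * Λ)) with hT
  have hbase : α ^ 4 * Λ ^ 4 ≤ T := by
    rw [hT, ← mul_assoc]
    exact le_mul_of_one_le_right (by positivity) hE
  have hk2 : α ^ 4 * Λ ^ 2 ≤ T := le_trans (by gcongr) hbase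
  have hk3 : α ^ 4 * Λ ^ 3 ≤ T := le_trans (by gcongr) hbase
  have t1 : |exp b - 1 - b| ≤ T := by
    refine (Real.abs_exp_sub_one_sub_id_le hb1).trans ?_
    rw [← sq_abs]
    calc |b| ^ 2 ≤ (Λ * α ^ 2) ^ 2 := by gcongr
      _ = α ^ 4 * Λ ^ 2 := by ring
      _ ≤ T := hk2
  have t2 : |exp b * (cosh s - 1 - s ^ 2 / 2)| ≤ 3 * T := by
    rw [abs_mul, abs_of_pos (exp_pos b)]
    have h3 : exp b ≤ 3 := by
      calc exp b ≤ exp 1 := Real.exp_le_exp.2 ((le_abs_self b).trans hb1)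
        _ ≤ 3 := Real.exp_one_lt_three.le
    have h4 : |cosh s - 1 - s ^ 2 / 2| ≤ T := by
      refine (abs_cosh_sub_le s).trans ?_
      calc |s| ^ 4 * exp |s| ≤ (Λ * α) ^ 4 * exp (Λ * α) := by gcongr
        _ = T := by rw [hT, mul_comm Λ α]; ring
    gcongr
  have t3 : |(exp b - 1) * (s ^ 2 / 2)| ≤ T := by
    rw [abs_mul, abs_of_nonneg (show 0 ≤ s ^ 2 / 2 by positivity), ← sq_abs s]
    calc _ ≤ (2 * |b|) * (|s| ^ 2 / 2) := by gcongr; exact Real.abs_exp_sub_one_le hb1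
      _ ≤ (2 * (Λ * α ^ 2)) * ((Λ * α) ^ 2 / 2) := by gcongr
      _ = α ^ 4 * Λ ^ 3 := by ring
      _ ≤ T := hk3
  have t4 : |(s ^ 2 - l ^ 2) / 2| ≤ T := by
    have : (s ^ 2 - l ^ 2) / 2 = (s - l) * ((s + l) / 2) := by ring
    have h5 : |(s + l) / 2| ≤ Λ * α := by
      rw [abs_div, abs_two, div_le_iff₀ two_pos]
      exact (abs_add_le _ _).trans (by linarith)
    rw [this, abs_mul]
    calc _ ≤ (Λ * α ^ 3) * (Λ * α) := by
          gcongr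
          exact hsl.trans (by gcongr)
      _ = α ^ 4 * Λ ^ 2 := by ring
      _ ≤ T := hk2
  have hsplit : exp b * cosh s - 1 - b - l ^ 2 / 2 = (exp b - 1 - b) +
      exp b * (cosh s - 1 - s ^ 2 / 2) + (exp b - 1) * (s ^ 2 / 2) + (s ^ 2 - l ^ 2) / 2 := by ring
  rw [hsplit]
  have : 0 ≤ T := by positivity
  refine (abs_add_le _ _).trans ?_
  have := abs_add_le (exp b - 1 - b + exp b * (cosh s - 1 - s ^ 2 / 2)) ((exp b - 1) * (s ^ 2 / 2))
  have := abs_add_le (exp b - 1 - b) (exp b * (cosh s - 1 - s ^ 2 / 2))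
  rw [mul_assoc, ← hT]
  linarith

section Average

variable {q : ℕ}

/-- The average of `exp (L(u) + t · u)` over the ellipsoid with semi-axes `a`. -/
noncomputable def avgRatio (L : EuclideanSpace ℝ (Fin q) → ℝ)
    (a t : EuclideanSpace ℝ (Fin q)) : ℝ :=
  ∫ v, exp (L (scale a v) + ∑ i, t i * scale a v i) ∂ballLaw q

/-- The even part of `L`, averaged over the ellipsoid with semi-axes `a`. -/
noncomputable def avgEven (L : EuclideanSpace ℝ (Fin q) → ℝ) (a : EuclideanSpace ℝ (Fin q)) : ℝ :=
  ∫ v, (L (scale a v) + L (-scale a v)) / 2 ∂ballLaw q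

variable {L : EuclideanSpace ℝ (Fin q) → ℝ} {l a : EuclideanSpace ℝ (Fin q)} {M : ℝ}

lemma sum_mul_eq_inner (t u : EuclideanSpace ℝ (Fin q)) : ∑ i, t i * u i = inner ℝ t u := by
  simp [PiLp.inner_apply, mul_comm]

/-- `L u` is the sum of its even and odd halves. This crude bound serves only for integrability. -/
lemma abs_le_of_parity (hM : 0 ≤ M) (ha1 : ‖a‖ ≤ 1) (hl : ‖l‖ ≤ q * M)
    (hL : ∀ u, ‖u‖ ≤ ‖a‖ → |L u + L (-u)| ≤ M * ‖u‖ ^ 2 ∧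
      |(L u - L (-u)) / 2 - ∑ i, l i * u i| ≤ M * ‖u‖ ^ 3)
    {u : EuclideanSpace ℝ (Fin q)} (hu : ‖u‖ ≤ ‖a‖) : |L u| ≤ (q + 2) * M := by
  obtain ⟨h1, h2⟩ := hL u hu
  have hu1 : ‖u‖ ≤ 1 := hu.trans ha1
  rw [sum_mul_eq_inner] at h2
  have h3 : |inner ℝ l u| ≤ q * M := by
    refine (abs_real_inner_le_norm l u).trans ?_
    calc ‖l‖ * ‖u‖ ≤ q * M * 1 := by gcongr
      _ = q * M := mul_one _
  have h4 : M * ‖u‖ ^ 2 ≤ M := mul_le_of_le_one_right hM (pow_le_one₀ (norm_nonneg _) hu1)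
  have h5 : M * ‖u‖ ^ 3 ≤ M := mul_le_of_le_one_right hM (pow_le_one₀ (norm_nonneg _) hu1)
  rw [abs_le] at *
  constructor <;> nlinarith [h1.1, h1.2, h2.1, h2.2, h3.1, h3.2]

lemma norm_scale_le_of_norm_le_one {v : EuclideanSpace ℝ (Fin q)} (hv : ‖v‖ ≤ 1) :
    ‖scale a v‖ ≤ ‖a‖ :=
  (norm_scale_le a v).trans (mul_le_of_le_one_right (norm_nonneg _) hv)

/-- Second order expansion of the average likelihood ratio. -/
lemma avgRatio_expansion (hLm : Measurable L) (hM : 0 ≤ M) (ha1 : ‖a‖ ≤ 1)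
    (hMa : M * ‖a‖ ^ 2 ≤ 1 / 2) (hl : ‖l‖ ≤ q * M)
    (hL : ∀ u, ‖u‖ ≤ ‖a‖ → |L u + L (-u)| ≤ M * ‖u‖ ^ 2 ∧
      |(L u - L (-u)) / 2 - ∑ i, l i * u i| ≤ M * ‖u‖ ^ 3)
    (t : EuclideanSpace ℝ (Fin q)) {Λ : ℝ} (hΛ : 1 + q * M + M + ‖t‖ ≤ Λ) :
    1 / 2 ≤ avgRatio L a t ∧ |avgEven L a| ≤ M * ‖a‖ ^ 2 ∧
    |avgRatio L a t - 1 - (avgEven L a + (∑ i, a i ^ 2 * (l i + t i) ^ 2) / (2 * (q + 2)))| ≤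
      7 * ‖a‖ ^ 4 * (Λ ^ 4 * exp (‖a‖ * Λ)) := by
  set α := ‖a‖ with hα
  have hα0 : 0 ≤ α := norm_nonneg a
  have hqM : 0 ≤ q * M := by positivity
  have ht0 := norm_nonneg t
  set E : EuclideanSpace ℝ (Fin q) → ℝ := fun v => exp (L (scale a v) + ∑ i, t i * scale a v i)
    with hE
  set b : EuclideanSpace ℝ (Fin q) → ℝ := fun v => (L (scale a v) + L (-scale a v)) / 2 with hb
  set s : EuclideanSpace ℝ (Fin q) → ℝ := fun v =>
    (L (scale a v) - L (-scale a v)) / 2 + ∑ i, t i * scale a v i with hs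
  set l' : EuclideanSpace ℝ (Fin q) → ℝ := fun v => ∑ i, (a i * (l i + t i)) * v i with hl'
  have hl'_eq : ∀ v, l' v = ∑ i, l i * scale a v i + ∑ i, t i * scale a v i := by
    intro v
    rw [← Finset.sum_add_distrib]
    exact Finset.sum_congr rfl fun i _ => by rw [scale_apply]; ring
  have hscm : Measurable (scale a) := (continuous_scale a).measurable
  have hL1 : Measurable fun v => L (scale a v) := hLm.comp hscm
  have hL2 : Measurable fun v => L (-scale a v) := hLm.comp hscm.neg
  have hlin : Measurable fun v : EuclideanSpace ℝ (Fin q) => ∑ i, t i * scale a v i := by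
    have : Continuous fun v : EuclideanSpace ℝ (Fin q) => ∑ i, t i * scale a v i := by
      simp only [scale_apply]
      fun_prop
    exact this.measurable
  have hEm : Measurable E := Real.measurable_exp.comp (hL1.add hlin)
  have hbm : Measurable b := (hL1.add hL2).div_const 2
  have hlin_le : ∀ v, ‖v‖ ≤ 1 → |∑ i, t i * scale a v i| ≤ ‖t‖ * α := by
    intro v hv
    rw [sum_mul_eq_inner]
    refine (abs_real_inner_le_norm _ _).trans ?_
    have := norm_scale_le_of_norm_le_one (a := a) hv
    gcongr
  have hEi : Integrable E (ballLaw q) := by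
    refine Integrable.of_bound hEm.aestronglyMeasurable (exp ((q + 2) * M + ‖t‖ * α)) ?_
    filter_upwards [ae_ballLaw_norm_le q] with v hv
    rw [Real.norm_of_nonneg (exp_pos _).le]
    refine Real.exp_le_exp.2 (add_le_add ?_ ((le_abs_self _).trans (hlin_le v hv)))
    exact (le_abs_self _).trans
      (abs_le_of_parity hM ha1 hl hL (norm_scale_le_of_norm_le_one hv))
  -- Averaging over `v` and `-v`, which does not alter the integral, splits the exponent into its
  -- even part `b` and odd part `s`.
  have hEneg : ∀ v, (E v + E (-v)) / 2 = exp (b v) * cosh (s v) := by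
    intro v
    have e1 : exp (b v) * exp (s v) = E v := by
      rw [← Real.exp_add]
      simp only [hE, hb, hs]
      congr 1
      ring
    have e2 : exp (b v) * exp (-s v) = E (-v) := by
      rw [← Real.exp_add]
      simp only [hE, hb, hs, scale_neg, PiLp.neg_apply, mul_neg, Finset.sum_neg_distrib]
      congr 1
      ring
    rw [Real.cosh_eq, ← e1, ← e2]
    ring
  have hEi' : Integrable (fun v => E (-v)) (ballLaw q) := by
    refine Integrable.of_bound (hEm.comp measurable_neg).aestronglyMeasurable
      (exp ((q + 2) * M + ‖t‖ * α)) ?_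
    filter_upwards [ae_ballLaw_norm_le q] with v hv
    have hv' : ‖-v‖ ≤ 1 := by rwa [norm_neg]
    rw [Real.norm_of_nonneg (exp_pos _).le]
    refine Real.exp_le_exp.2 (add_le_add ?_ ((le_abs_self _).trans (hlin_le _ hv')))
    exact (le_abs_self _).trans
      (abs_le_of_parity hM ha1 hl hL (norm_scale_le_of_norm_le_one hv'))
  have hGi : Integrable (fun v => exp (b v) * cosh (s v)) (ballLaw q) := by
    simp only [← hEneg]
    exact (hEi.add hEi').div_const 2
  have hG : avgRatio L a t = ∫ v, exp (b v) * cosh (s v) ∂ballLaw q := by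
    simp only [← hEneg]
    rw [integral_div, integral_add hEi hEi', integral_ballLaw_neg E]
    simp only [avgRatio, hE]
    ring
  have hbb : ∀ v, ‖v‖ ≤ 1 → |b v| ≤ M * α ^ 2 := by
    intro v hv
    have hsc := norm_scale_le_of_norm_le_one (a := a) hv
    have h1 := (hL _ hsc).1
    have h2 : M * ‖scale a v‖ ^ 2 ≤ M * α ^ 2 := by gcongr
    simp only [hb]
    rw [abs_div, abs_two]
    have := abs_nonneg (L (scale a v) + L (-scale a v))
    linarith
  have hbi : Integrable b (ballLaw q) := by
    refine Integrable.of_bound hbm.aestronglyMeasurable (M * α ^ 2) ?_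
    filter_upwards [ae_ballLaw_norm_le q] with v hv
    exact hbb v hv
  have hl'i : Integrable (fun v => l' v ^ 2 / 2) (ballLaw q) :=
    integrable_ballLaw_of_continuous (by fun_prop)
  refine ⟨?_, ?_, ?_⟩
  -- Since `exp b ≥ 1 + b ≥ 1/2` and `cosh ≥ 1`, the ratio stays away from 0, as the logarithmic
  -- expansion later requires.
  · rw [hG]
    have : ∫ _v, (1 / 2 : ℝ) ∂ballLaw q ≤ ∫ v, exp (b v) * cosh (s v) ∂ballLaw q := by
      refine integral_mono_ae (integrable_const _) hGi ?_
      filter_upwards [ae_ballLaw_norm_le q] with v hv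
      have h1 := (abs_le.1 (hbb v hv)).1
      have h2 := Real.add_one_le_exp (b v)
      have h3 := Real.one_le_cosh (s v)
      nlinarith
    simpa using this
  · have := norm_integral_le_of_norm_le_const (μ := ballLaw q) (f := b) (C := M * α ^ 2) (by
      filter_upwards [ae_ballLaw_norm_le q] with v hv
      exact hbb v hv)
    simpa [avgEven] using this
  · have hquad : ∫ v, l' v ^ 2 / 2 ∂ballLaw q =
        (∑ i, a i ^ 2 * (l i + t i) ^ 2) / (2 * (q + 2)) := by
      rw [integral_div, integral_ballLaw_linear_sq]
      simp only [mul_pow]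
      field_simp
    have hdiff : avgRatio L a t - 1 -
        (avgEven L a + (∑ i, a i ^ 2 * (l i + t i) ^ 2) / (2 * (q + 2))) =
        ∫ v, (exp (b v) * cosh (s v) - 1 - b v - l' v ^ 2 / 2) ∂ballLaw q := by
      have i1 : Integrable (fun v => exp (b v) * cosh (s v) - 1) (ballLaw q) :=
        hGi.sub (integrable_const 1)
      have i2 : Integrable (fun v => exp (b v) * cosh (s v) - 1 - b v) (ballLaw q) := i1.sub hbi
      rw [integral_sub i2 hl'i, integral_sub i1 hbi, integral_sub hGi (integrable_const 1), hquad,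
        ← hG]
      simp [avgEven, hb]
      ring
    rw [hdiff]
    have := norm_integral_le_of_norm_le_const (μ := ballLaw q)
      (f := fun v => exp (b v) * cosh (s v) - 1 - b v - l' v ^ 2 / 2)
      (C := 7 * α ^ 4 * (Λ ^ 4 * exp (α * Λ))) (by
      filter_upwards [ae_ballLaw_norm_le q] with v hv
      have hsc := norm_scale_le_of_norm_le_one (a := a) hv
      have h2 := (hL _ hsc).2
      have hlle : |l' v| ≤ (q * M + ‖t‖) * α := by
        rw [hl'_eq]
        have h3 : |∑ i, l i * scale a v i| ≤ q * M * α := by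
          rw [sum_mul_eq_inner]
          refine (abs_real_inner_le_norm _ _).trans ?_
          gcongr
        have := hlin_le v hv
        refine (abs_add_le _ _).trans ?_
        linarith
      have hsl : |s v - l' v| ≤ M * α ^ 3 := by
        rw [hl'_eq]
        have e : s v - (∑ i, l i * scale a v i + ∑ i, t i * scale a v i) =
          (L (scale a v) - L (-scale a v)) / 2 - ∑ i, l i * scale a v i := by
          simp only [hs]
          ring
        rw [e]
        exact h2.trans (by gcongr)
      have hα3 : α ^ 3 ≤ α := pow_le_of_le_one hα0 ha1 (by norm_num)
      have hsle : |s v| ≤ (q * M + ‖t‖) * α + M * α := by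
        have h4 : |s v| ≤ |s v - l' v| + |l' v| := by
          simpa using abs_add_le (s v - l' v) (l' v)
        have h5 : M * α ^ 3 ≤ M * α := by gcongr
        linarith
      refine abs_exp_mul_cosh_sub_le hα0 (by linarith) (by linarith) (by linarith)
        (hbb v hv) (hlle.trans ?_) (hsle.trans ?_) hsl
      · gcongr
        linarith
      · rw [← add_mul]
        gcongr
        linarith)
    simpa using this

end Average

/-! ### The simulated posterior as a reweighted posterior. -/

section

variable {d m q : ℕ} {F : ExpFamily d m q}

lemma measurable_logInc {Rn : EuclideanSpace ℝ (Fin q) → ℝ} (h : Measurable Rn)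
    (y₀ : EuclideanSpace ℝ (Fin q)) : Measurable (logInc Rn y₀) :=
  (Real.measurable_log.comp (h.comp (measurable_const_add y₀))).sub_const _

/-- The joint density at a displaced statistic, relative to the one at `τs`. -/
lemma ExpFamily.jointDensity_displaced {ρ : EuclideanSpace ℝ (Fin q)} {κ : ℝ} {n : ℕ}
    {Rn : EuclideanSpace ℝ (Fin q) → ℝ} {τs ε v : EuclideanSpace ℝ (Fin q)}
    (h0 : 0 < Rn ((n : ℝ) • τs)) (hv : 0 < Rn ((n : ℝ) • τs + scale ((n : ℝ) • ε) v))
    (θ : EuclideanSpace ℝ (Fin m)) :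
    F.jointDensity ρ κ n Rn (τs + scale ε v) θ =
      exp (logInc Rn ((n : ℝ) • τs) (scale ((n : ℝ) • ε) v) +
        ∑ i, F.η θ i * scale ((n : ℝ) • ε) v i) * F.jointDensity ρ κ n Rn τs θ := by
  have h1 : (n : ℝ) • (τs + scale ε v) = (n : ℝ) • τs + scale ((n : ℝ) • ε) v := by
    ext i
    simp
    ring
  have h2 : Rn ((n : ℝ) • τs + scale ((n : ℝ) • ε) v) =
      Rn ((n : ℝ) • τs) * exp (logInc Rn ((n : ℝ) • τs) (scale ((n : ℝ) • ε) v)) := by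
    rw [logInc, Real.exp_sub, Real.exp_log hv, Real.exp_log h0]
    field_simp
  have h3 : n * ∑ i, F.η θ i * (τs + scale ε v) i - n * F.A θ =
      (n * ∑ i, F.η θ i * τs i - n * F.A θ) + ∑ i, F.η θ i * scale ((n : ℝ) • ε) v i := by
    have : ∑ i, F.η θ i * scale ((n : ℝ) • ε) v i = n * ∑ i, F.η θ i * scale ε v i := by
      rw [Finset.mul_sum]
      exact Finset.sum_congr rfl fun i _ => by simp; ring
    rw [this]
    simp only [PiLp.add_apply, mul_add, Finset.sum_add_distrib]
    ring
  rw [jointDensity, jointDensity, statDensity, statDensity, h1, h2, h3, Real.exp_add, Real.exp_add]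
  ring

/-- The simulated posterior is the posterior reweighted by the average likelihood ratio. -/
lemma ExpFamily.abcPosterior_eq_withDensity {ρ : EuclideanSpace ℝ (Fin q)} {κ : ℝ} {n : ℕ}
    {Rn : EuclideanSpace ℝ (Fin q) → ℝ} {τs ε : EuclideanSpace ℝ (Fin q)} {B : ℝ}
    (hη : AEStronglyMeasurable F.η (volume.restrict F.Θ))
    (hRm : Measurable Rn) (hR0 : ∀ y, 0 ≤ Rn y)
    (hpos : ∀ u, ‖u‖ ≤ ‖(n : ℝ) • ε‖ → 0 < Rn ((n : ℝ) • τs + u))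
    (hB : ∀ u, ‖u‖ ≤ ‖(n : ℝ) • ε‖ → |logInc Rn ((n : ℝ) • τs) u| ≤ B)
    (hε : ∀ i, 0 < ε i)
    (hJ : IntegrableOn (F.jointDensity ρ κ n Rn τs) F.Θ)
    (hmarg : 0 < F.marginal ρ κ n Rn τs)
    (hexp : Integrable (fun θ => exp (‖(n : ℝ) • ε‖ * ‖F.η θ‖)) (F.posterior ρ κ n Rn τs)) :
    Integrable (fun θ => avgRatio (logInc Rn ((n : ℝ) • τs)) ((n : ℝ) • ε) (F.η θ))
      (F.posterior ρ κ n Rn τs) ∧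
    F.abcPosterior ρ κ n Rn τs ε = (F.posterior ρ κ n Rn τs).withDensity fun θ =>
      ENNReal.ofReal (avgRatio (logInc Rn ((n : ℝ) • τs)) ((n : ℝ) • ε) (F.η θ) /
        ∫ θ', avgRatio (logInc Rn ((n : ℝ) • τs)) ((n : ℝ) • ε) (F.η θ')
          ∂F.posterior ρ κ n Rn τs) := by
  set a := (n : ℝ) • ε with ha
  set L := logInc Rn ((n : ℝ) • τs) with hL
  set P := F.posterior ρ κ n Rn τs with hP
  set J := F.jointDensity ρ κ n Rn τs with hJdef
  have hJ0 : ∀ θ, 0 ≤ J θ := F.jointDensity_nonneg hR0 τs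
  have hprob : IsProbabilityMeasure P := isProbabilityMeasure_normalized hJ hJ0 hmarg
  have hPac : P ≪ volume.restrict F.Θ := withDensity_absolutelyContinuous _ _
  set e : EuclideanSpace ℝ (Fin q) × EuclideanSpace ℝ (Fin m) → ℝ := fun z =>
    exp (L (scale a z.1) + ∑ i, F.η z.2 i * scale a z.1 i) with he
  have hηP : AEMeasurable F.η P := hη.aemeasurable.mono_ac hPac
  have hη2 : AEMeasurable (fun z : EuclideanSpace ℝ (Fin q) × EuclideanSpace ℝ (Fin m) => F.η z.2)
      ((ballLaw q).prod P) := hηP.comp_snd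
  have hem : AEStronglyMeasurable e ((ballLaw q).prod P) := by
    refine AEMeasurable.aestronglyMeasurable ?_
    refine Real.measurable_exp.comp_aemeasurable (AEMeasurable.add ?_ ?_)
    · exact ((measurable_logInc hRm _).comp
        ((continuous_scale a).measurable.comp measurable_fst)).aemeasurable
    · refine Finset.aemeasurable_fun_sum _ fun i _ => AEMeasurable.mul ?_ ?_
      · exact (EuclideanSpace.proj (𝕜 := ℝ) i).continuous.measurable.comp_aemeasurable hη2
      · exact ((EuclideanSpace.proj (𝕜 := ℝ) i).continuous.measurable.comp
          ((continuous_scale a).measurable.comp measurable_fst)).aemeasurable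
  have hei : Integrable e ((ballLaw q).prod P) := by
    refine ((hexp.comp_snd (ballLaw q)).const_mul (exp B)).mono' hem ?_
    filter_upwards [Measure.quasiMeasurePreserving_fst.ae (ae_ballLaw_norm_le q)] with z hz
    have hsc := norm_scale_le_of_norm_le_one (a := a) hz
    rw [Real.norm_of_nonneg (exp_pos _).le, ← Real.exp_add]
    refine Real.exp_le_exp.2 (add_le_add ((le_abs_self _).trans (hB _ hsc)) ?_)
    rw [sum_mul_eq_inner]
    refine (real_inner_le_norm _ _).trans ?_
    rw [mul_comm]
    gcongr
  have hh : ∀ θ, avgRatio L a (F.η θ) = ∫ v, e (v, θ) ∂ballLaw q := fun θ => rfl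
  have hhi : Integrable (fun θ => avgRatio L a (F.η θ)) P := hei.integral_prod_right
  refine ⟨hhi, ?_⟩
  have h0 : 0 < Rn ((n : ℝ) • τs) := by simpa using hpos 0 (by simp)
  have hdisp : ∀ v, ‖v‖ ≤ 1 → ∀ θ,
      F.jointDensity ρ κ n Rn (τs + scale ε v) θ = e (v, θ) * J θ := fun v hv θ =>
    jointDensity_displaced h0 (hpos _ (norm_scale_le_of_norm_le_one hv)) θ
  have hnum : ∀ θ, ⨍ τ in ellipse ε τs, F.jointDensity ρ κ n Rn τ θ =
      avgRatio L a (F.η θ) * J θ := by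
    intro θ
    rw [setAverage_ellipse hε τs fun τ => F.jointDensity ρ κ n Rn τ θ, hh, ← integral_mul_const]
    refine integral_congr_ae ?_
    filter_upwards [ae_ballLaw_norm_le q] with v hv
    exact hdisp v hv θ
  have hden : ⨍ τ in ellipse ε τs, F.marginal ρ κ n Rn τ =
      F.marginal ρ κ n Rn τs * ∫ θ, avgRatio L a (F.η θ) ∂P := by
    rw [setAverage_ellipse hε]
    have h1 : ∀ v, ‖v‖ ≤ 1 → F.marginal ρ κ n Rn (τs + scale ε v) =
        F.marginal ρ κ n Rn τs * ∫ θ, e (v, θ) ∂P := by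
      intro v hv
      have h2 : ∫ θ, e (v, θ) ∂P = (∫ θ in F.Θ, e (v, θ) * J θ) / F.marginal ρ κ n Rn τs :=
        integral_normalized hJ hJ0 hmarg _
      rw [h2, mul_div_cancel₀ _ hmarg.ne', marginal]
      exact integral_congr_ae (ae_of_all _ fun θ => hdisp v hv θ)
    have h3 : ∫ v, F.marginal ρ κ n Rn (τs + scale ε v) ∂ballLaw q =
        ∫ v, F.marginal ρ κ n Rn τs * ∫ θ, e (v, θ) ∂P ∂ballLaw q := by
      refine integral_congr_ae ?_
      filter_upwards [ae_ballLaw_norm_le q] with v hv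
      exact h1 v hv
    rw [h3, integral_const_mul]
    congr 1
    -- Fubini: the average of `f_T` over the ellipse, relative to `f_T(τ*)`, is the posterior mean
    -- of the averaged ratio.
    exact integral_integral_swap (f := fun v θ => e (v, θ)) hei
  -- Measurability is needed for Lebesgue measure on `Θ`, not only for the posterior, because the
  -- two densities are multiplied over that base measure.
  have hhv : AEMeasurable (fun θ => avgRatio L a (F.η θ)) (volume.restrict F.Θ) := by
    have hmL : Measurable (avgRatio L a) := by
      refine StronglyMeasurable.measurable ?_
      unfold avgRatio
      refine StronglyMeasurable.integral_prod_right' (f := fun z :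
        EuclideanSpace ℝ (Fin q) × EuclideanSpace ℝ (Fin q) =>
        exp (L (scale a z.2) + ∑ i, z.1 i * scale a z.2 i)) ?_
      refine Measurable.stronglyMeasurable (Real.measurable_exp.comp (Measurable.add ?_ ?_))
      · exact (measurable_logInc hRm _).comp
          ((continuous_scale a).measurable.comp measurable_snd)
      · refine Finset.measurable_fun_sum _ fun i _ => Measurable.mul ?_ ?_
        · exact (EuclideanSpace.proj (𝕜 := ℝ) i).continuous.measurable.comp measurable_fst
        · exact (EuclideanSpace.proj (𝕜 := ℝ) i).continuous.measurable.comp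
            ((continuous_scale a).measurable.comp measurable_snd)
    exact hmL.comp_aemeasurable hη.aemeasurable
  rw [hP, posterior, abcPosterior,
    ← withDensity_mul₀ (hJ.aemeasurable.div_const _).ennreal_ofReal
      (hhv.div_const _).ennreal_ofReal]
  congr 1
  funext θ
  rw [Pi.mul_apply, ← ENNReal.ofReal_mul (div_nonneg (hJ0 θ) hmarg.le), hnum, hden]
  congr 1
  rw [div_mul_div_comm, mul_comm (J θ)]
  rfl

/-- The exponential budget `c` is halved: one half dominates the power `Λ ^ 12`, the other the
factor `exp (3δΛ)`. The cube is the one demanded of `Ψ` in the Jensen gap. -/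
lemma pow_mul_exp_le {c Λ δ : ℝ} (hc : 0 < c) (hΛ : 0 ≤ Λ) (hδ : 3 * δ ≤ c / 2) :
    (Λ ^ 4 * exp (δ * Λ)) ^ 3 ≤ (Nat.factorial 12 : ℝ) * (2 / c) ^ 12 * exp (c * Λ) := by
  have h1 : (c / 2 * Λ) ^ 12 / (Nat.factorial 12 : ℝ) ≤ exp (c / 2 * Λ) :=
    Real.pow_div_factorial_le_exp _ (by positivity) 12
  rw [div_le_iff₀ (by positivity)] at h1
  have h2 : Λ ^ 12 ≤ (Nat.factorial 12 : ℝ) * (2 / c) ^ 12 * exp (c / 2 * Λ) := by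
    have e : Λ ^ 12 = (2 / c) ^ 12 * (c / 2 * Λ) ^ 12 := by
      rw [← mul_pow]
      congr 1
      field_simp
    rw [e]
    calc _ ≤ (2 / c) ^ 12 * (exp (c / 2 * Λ) * (Nat.factorial 12 : ℝ)) := by gcongr
      _ = _ := by ring
  have h3 : exp (δ * Λ) ^ 3 ≤ exp (c / 2 * Λ) := by
    rw [← Real.exp_nat_mul]
    refine Real.exp_le_exp.2 ?_
    push_cast
    nlinarith
  calc (Λ ^ 4 * exp (δ * Λ)) ^ 3 = Λ ^ 12 * exp (δ * Λ) ^ 3 := by ring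
    _ ≤ ((Nat.factorial 12 : ℝ) * (2 / c) ^ 12 * exp (c / 2 * Λ)) * exp (c / 2 * Λ) := by gcongr
    _ = (Nat.factorial 12 : ℝ) * (2 / c) ^ 12 * (exp (c / 2 * Λ) * exp (c / 2 * Λ)) := by ring
    _ = _ := by
      rw [← Real.exp_add]
      congr 2
      ring

end

/-- Centering of the quadratic approximation of the likelihood ratio. -/
lemma integral_sq_centered {Ω : Type*} [MeasurableSpace Ω] {P : Measure Ω}
    [IsProbabilityMeasure P] {q : ℕ} {ε l : EuclideanSpace ℝ (Fin q)}
    {η : Ω → EuclideanSpace ℝ (Fin q)} (hη : ∀ i, MemLp (fun x => η x i) 2 P) (β N : ℝ) :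
    (∫ x, (β + (∑ i, (N • ε) i ^ 2 * (l i + η x i) ^ 2) / (2 * (q + 2)) -
        ∫ x', (β + (∑ i, (N • ε) i ^ 2 * (l i + η x' i) ^ 2) / (2 * (q + 2))) ∂P) ^ 2 ∂P) / 2 =
      N ^ 4 / (8 * ((q : ℝ) + 2) ^ 2) * ∫ x, (∑ i, ε i ^ 2 *
        (η x i ^ 2 - (∫ x', η x' i ^ 2 ∂P) + 2 * l i * (η x i - ∫ x', η x' i ∂P))) ^ 2 ∂P := by
  have h1 : ∀ i, Integrable (fun x => η x i) P := fun i => (hη i).integrable one_le_two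
  have h2 : ∀ i, Integrable (fun x => η x i ^ 2) P := fun i => (hη i).integrable_sq
  have hexp : ∀ i, (fun x => (N • ε) i ^ 2 * (l i + η x i) ^ 2) = fun x =>
      (N * ε i) ^ 2 * (l i ^ 2 + (2 * l i * η x i + η x i ^ 2)) := by
    intro i
    funext x
    simp only [PiLp.smul_apply, smul_eq_mul]
    ring
  have hi : ∀ i, Integrable (fun x => 2 * l i * η x i + η x i ^ 2) P := fun i =>
    ((h1 i).const_mul (2 * l i)).add (h2 i)
  have hi' : ∀ i, Integrable (fun x => l i ^ 2 + (2 * l i * η x i + η x i ^ 2)) P := fun i =>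
    (integrable_const _).add (hi i)
  have hi'' : ∀ i, Integrable (fun x => (N • ε) i ^ 2 * (l i + η x i) ^ 2) P := by
    intro i
    rw [hexp]
    exact (hi' i).const_mul _
  have hterm : ∀ i, ∫ x, (N • ε) i ^ 2 * (l i + η x i) ^ 2 ∂P =
      (N * ε i) ^ 2 * (l i ^ 2 + (2 * l i * (∫ x, η x i ∂P) + ∫ x, η x i ^ 2 ∂P)) := by
    intro i
    rw [hexp, integral_const_mul, integral_add (integrable_const _) (hi i),
      integral_add ((h1 i).const_mul _) (h2 i), integral_const_mul]
    simp
  have hmean : ∫ x', (β + (∑ i, (N • ε) i ^ 2 * (l i + η x' i) ^ 2) / (2 * (q + 2))) ∂P =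
      β + (∑ i, (N * ε i) ^ 2 *
        (l i ^ 2 + (2 * l i * (∫ x, η x i ∂P) + ∫ x, η x i ^ 2 ∂P))) / (2 * (q + 2)) := by
    rw [integral_add (integrable_const _)
      ((integrable_finsetSum _ fun i _ => hi'' i).div_const _), integral_div,
      integral_finsetSum _ fun i _ => hi'' i]
    simp only [hterm]
    simp
  rw [hmean, ← integral_const_mul, ← integral_div]
  congr 1
  funext x
  -- Centring removes `β` and every `l i ^ 2`, so neither the even part of `log R_n` nor the squared
  -- derivatives enter the leading term.
  have hdiff : β + (∑ i, (N • ε) i ^ 2 * (l i + η x i) ^ 2) / (2 * ((q : ℝ) + 2)) -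
      (β + (∑ i, (N * ε i) ^ 2 *
        (l i ^ 2 + (2 * l i * (∫ x, η x i ∂P) + ∫ x, η x i ^ 2 ∂P))) / (2 * (q + 2))) =
      N ^ 2 / (2 * (q + 2)) * ∑ i, ε i ^ 2 *
        (η x i ^ 2 - (∫ x', η x' i ^ 2 ∂P) + 2 * l i * (η x i - ∫ x', η x' i ∂P)) := by
    rw [add_sub_add_left_eq_sub, ← sub_div, ← Finset.sum_sub_distrib, div_mul_eq_mul_div,
      Finset.mul_sum]
    congr 1
    refine Finset.sum_congr rfl fun i _ => ?_
    simp only [PiLp.smul_apply, smul_eq_mul]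
    ring
  rw [hdiff]
  have : (q : ℝ) + 2 ≠ 0 := by positivity
  field_simp
  ring

end ABC

/-! ### Assembly of the entropy expansion. -/

theorem mainTheorem2 {d m q : ℕ} (F : ABC.ExpFamily d m q)
    (ρ : EuclideanSpace ℝ (Fin q)) (κ : ℝ)
    (hprior : IntegrableOn (F.priorWeight ρ κ) F.Θ)
    (R : ℕ → EuclideanSpace ℝ (Fin q) → ℝ) (N : ℕ) (hN : 1 ≤ N)
    (hR : ∀ n ≥ N, F.IsStatCarrier n (R n))
    (τs : EuclideanSpace ℝ (Fin q))
    (hreg : F.Regular R N τs)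
    (hlog : ABC.LogDerivBounded R N τs)
    (hmax : F.UniqueNondegMax τs) :
    ∃ δ : ℝ, 0 < δ ∧ ∃ C : ℝ, ∀ n ≥ N, ∀ ε : EuclideanSpace ℝ (Fin q),
      (∀ i, 0 < ε i) → n * ‖ε‖ < δ →
        let P := F.posterior ρ κ n (R n) τs
        let Pε := F.abcPosterior ρ κ n (R n) τs ε
        IsProbabilityMeasure P ∧ IsProbabilityMeasure Pε ∧
        (∀ i, MemLp (fun θ => F.η θ i) 4 P) ∧
        InformationTheory.klDiv P Pε ≠ ⊤ ∧
        |(InformationTheory.klDiv P Pε).toReal -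
            (n : ℝ) ^ 4 / (8 * ((q : ℝ) + 2) ^ 2) *
              ∫ θ, (∑ i, ε i ^ 2 *
                (F.η θ i ^ 2 - (∫ θ', F.η θ' i ^ 2 ∂P) +
                  2 * ABC.iterPartial 1 i (fun y => Real.log (R n y)) ((n : ℝ) • τs) *
                    (F.η θ i - (∫ θ', F.η θ' i ∂P)))) ^ 2 ∂P|
          ≤ C * (n * ‖ε‖) ^ 6 := by
  obtain ⟨r, hr, M, hM, hlogInc⟩ := hreg.exists_logInc_bounds hlog
  obtain ⟨c, hc, K, hmoment⟩ :=
    ABC.ExpFamily.exists_posterior_moment_bound hprior hN hR hreg hmax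
  -- `r` keeps `nε` where `log R_n` is controlled; 1 lets higher powers of `‖a‖` be absorbed by
  -- lower ones; `c / 6` gives `Ψ ^ 3` exponential rate at most `c / 2`; the last entry gives `M‖a‖²
  -- ≤ 1/2`, hence a ratio of at least `1/2`.
  set δ : ℝ := min (min r 1) (min (c / 6) (1 / (2 * (M + 1)))) with hδ
  have hδ0 : 0 < δ := by positivity
  have hδr : δ ≤ r := (min_le_left _ _).trans (min_le_left _ _)
  have hδ1 : δ ≤ 1 := (min_le_left _ _).trans (min_le_right _ _)
  have hδc : δ ≤ c / 6 := (min_le_right _ _).trans (min_le_left _ _)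
  have hδM : δ ≤ 1 / (2 * (M + 1)) := (min_le_right _ _).trans (min_le_right _ _)
  set A : ℝ := 1 + q * M + M with hA
  set K' : ℝ := (Nat.factorial 12 : ℝ) * (2 / c) ^ 12 * exp (c * A) * K with hK'
  -- The constant of the Jensen gap estimate with `C = 7`, the 7 being that of `avgRatio_expansion`.
  refine ⟨δ, hδ0, 16 * 7 ^ 3 * K' + 16 * 7 ^ 3 * K' ^ 3 + 3 * 7 ^ 2 * K' + 3 * 7 ^ 2 * K' ^ 2,
    fun n hn ε hε hεδ => ?_⟩
  obtain ⟨hJ, hmarg, hexp, hexpK⟩ := hmoment n hn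
  obtain ⟨hRpos, hl, hpar⟩ := hlogInc n hn
  intro P Pε
  have hprob : IsProbabilityMeasure P :=
    ABC.isProbabilityMeasure_normalized hJ (F.jointDensity_nonneg (hR n hn).nonneg τs) hmarg
  set a := (n : ℝ) • ε with ha
  have hα : ‖a‖ = n * ‖ε‖ := by rw [ha, norm_smul, Real.norm_of_nonneg (Nat.cast_nonneg n)]
  have haδ : ‖a‖ < δ := by rwa [hα]
  have ha1 : ‖a‖ ≤ 1 := haδ.le.trans hδ1
  set L := ABC.logInc (R n) ((n : ℝ) • τs) with hL
  set l : EuclideanSpace ℝ (Fin q) := WithLp.toLp 2 fun i =>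
    ABC.iterPartial 1 i (fun y => Real.log (R n y)) ((n : ℝ) • τs) with hl_def
  have hl_norm : ‖l‖ ≤ q * M := ABC.norm_le_of_abs_le hl
  have hMa : M * ‖a‖ ^ 2 ≤ 1 / 2 := by
    have h1 : ‖a‖ ≤ 1 / (2 * (M + 1)) := haδ.le.trans hδM
    rw [le_div_iff₀ (by positivity)] at h1
    have h2 : ‖a‖ ^ 2 ≤ ‖a‖ := pow_le_of_le_one (norm_nonneg _) ha1 (by norm_num)
    nlinarith [mul_le_mul_of_nonneg_left h2 hM, norm_nonneg a]
  have hparL : ∀ u, ‖u‖ ≤ ‖a‖ → |L u + L (-u)| ≤ M * ‖u‖ ^ 2 ∧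
      |(L u - L (-u)) / 2 - ∑ i, l i * u i| ≤ M * ‖u‖ ^ 3 := fun u hu =>
    hpar u (hu.trans_lt (haδ.trans_le hδr))
  have hLm : Measurable L := ABC.measurable_logInc (hR n hn).measurable _
  have hηm : AEStronglyMeasurable F.η (volume.restrict F.Θ) :=
    hreg.smooth_η.continuousOn.aestronglyMeasurable F.measurableSet_Θ
  have hηP : AEStronglyMeasurable F.η P :=
    hηm.mono_ac (withDensity_absolutelyContinuous _ _)
  have hηi : ∀ i, AEStronglyMeasurable (fun θ => F.η θ i) P := fun i =>
    (EuclideanSpace.proj (𝕜 := ℝ) i).continuous.comp_aestronglyMeasurable hηP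
  have hmem : ∀ i, MemLp (fun θ => F.η θ i) 4 P := by
    intro i
    rw [← integrable_norm_rpow_iff (hηi i) (by norm_num) (by norm_num)]
    refine (hexp.const_mul ((Nat.factorial 4 : ℝ) / c ^ 4)).mono'
      ((hηi i).norm.aemeasurable.pow_const _).aestronglyMeasurable (ae_of_all _ fun θ => ?_)
    have h1 : (c * ‖F.η θ‖) ^ 4 / (Nat.factorial 4 : ℝ) ≤ exp (c * ‖F.η θ‖) :=
      Real.pow_div_factorial_le_exp _ (by positivity) 4
    have h2 : ‖F.η θ i‖ ^ 4 ≤ ‖F.η θ‖ ^ 4 := by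
      gcongr
      exact PiLp.norm_apply_le _ i
    have h3 : ‖F.η θ i‖ ^ (4 : ENNReal).toReal = ‖F.η θ i‖ ^ 4 := by
      rw [ENNReal.toReal_ofNat]
      norm_cast
    rw [h3, Real.norm_of_nonneg (by positivity)]
    rw [div_le_iff₀ (by positivity), mul_pow] at h1
    rw [div_mul_eq_mul_div, le_div_iff₀ (by positivity)]
    calc ‖F.η θ i‖ ^ 4 * c ^ 4 ≤ ‖F.η θ‖ ^ 4 * c ^ 4 := by gcongr
      _ ≤ _ := by linarith
  have hexpa : Integrable (fun θ => exp (‖a‖ * ‖F.η θ‖)) P := by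
    refine hexp.mono' (Real.continuous_exp.comp_aestronglyMeasurable (hηP.norm.const_mul _))
      (ae_of_all _ fun θ => ?_)
    rw [Real.norm_of_nonneg (exp_pos _).le]
    refine Real.exp_le_exp.2 ?_
    have : ‖a‖ ≤ c := by linarith
    gcongr
  obtain ⟨hhi, hPε⟩ := ABC.ExpFamily.abcPosterior_eq_withDensity hηm (hR n hn).measurable
    (hR n hn).nonneg (fun u hu => hRpos u (hu.trans_lt (haδ.trans_le hδr)))
    (fun u hu => ABC.abs_le_of_parity hM ha1 hl_norm hparL hu) hε hJ hmarg hexpa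
  set h := fun θ => ABC.avgRatio L a (F.η θ) with hh
  have hexpand := fun θ => ABC.avgRatio_expansion hLm hM ha1 hMa hl_norm hparL (F.η θ)
    (Λ := A + ‖F.η θ‖) le_rfl
  set x : EuclideanSpace ℝ (Fin m) → ℝ := fun θ =>
    ABC.avgEven L a + (∑ i, a i ^ 2 * (l i + F.η θ i) ^ 2) / (2 * (q + 2)) with hx
  -- The envelope has `δ` in place of `‖a‖` in the exponent, so that it does not depend on `ε`.
  set Ψ : EuclideanSpace ℝ (Fin m) → ℝ := fun θ =>
    (A + ‖F.η θ‖) ^ 4 * exp (δ * (A + ‖F.η θ‖)) with hΨ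
  have hA1 : 1 ≤ A := by
    have : 0 ≤ q * M := by positivity
    linarith
  have hΛ1 : ∀ θ, 1 ≤ A + ‖F.η θ‖ := fun θ => by linarith [norm_nonneg (F.η θ)]
  have hexp1 : ∀ θ, 1 ≤ exp (δ * (A + ‖F.η θ‖)) := fun θ =>
    Real.one_le_exp (mul_nonneg hδ0.le (by linarith [hΛ1 θ]))
  have hΨ2 : ∀ θ, (A + ‖F.η θ‖) ^ 2 ≤ Ψ θ := fun θ =>
    (pow_le_pow_right₀ (hΛ1 θ) (by norm_num : 2 ≤ 4)).trans
      (le_mul_of_one_le_right (by have := hΛ1 θ; positivity) (hexp1 θ))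
  have hΨ1 : ∀ θ, 1 ≤ Ψ θ := fun θ => (one_le_pow₀ (hΛ1 θ)).trans (hΨ2 θ)
  have hΨm : AEStronglyMeasurable Ψ P :=
    (show Continuous fun s : ℝ => (A + s) ^ 4 * exp (δ * (A + s)) by
      fun_prop).comp_aestronglyMeasurable hηP.norm
  have hΨ3 : ∀ θ, Ψ θ ^ 3 ≤
      (Nat.factorial 12 : ℝ) * (2 / c) ^ 12 * exp (c * A) * exp (c * ‖F.η θ‖) := by
    intro θ
    refine (ABC.pow_mul_exp_le hc (by linarith [hΛ1 θ]) (by linarith)).trans (le_of_eq ?_)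
    rw [mul_add, Real.exp_add]
    ring
  have hΨi : Integrable (fun θ => Ψ θ ^ 3) P :=
    (hexp.const_mul _).mono' (hΨm.pow 3) (ae_of_all _ fun θ => by
      rw [Real.norm_of_nonneg (pow_nonneg (zero_le_one.trans (hΨ1 θ)) 3)]
      exact hΨ3 θ)
  have hΨK : ∫ θ, Ψ θ ^ 3 ∂P ≤ K' := by
    refine (integral_mono hΨi (hexp.const_mul _) hΨ3).trans ?_
    rw [integral_const_mul, hK']
    gcongr
  have hxm : AEStronglyMeasurable x P :=
    (show Continuous fun t : EuclideanSpace ℝ (Fin q) =>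
      ABC.avgEven L a + (∑ i, a i ^ 2 * (l i + t i) ^ 2) / (2 * ((q : ℝ) + 2)) by
        fun_prop).comp_aestronglyMeasurable hηP
  have hxb : ∀ θ, |x θ| ≤ 7 * ‖a‖ ^ 2 * Ψ θ := by
    intro θ
    have h1 := (hexpand θ).2.1
    have h2 : ∑ i, a i ^ 2 * (l i + F.η θ i) ^ 2 ≤ ‖a‖ ^ 2 * (A + ‖F.η θ‖) ^ 2 := by
      rw [EuclideanSpace.real_norm_sq_eq, Finset.sum_mul]
      refine Finset.sum_le_sum fun i _ => ?_
      have h3 : |l i + F.η θ i| ≤ A + ‖F.η θ‖ := by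
        have h4 := PiLp.norm_apply_le (l + F.η θ) i
        have h5 := norm_add_le l (F.η θ)
        rw [Real.norm_eq_abs, PiLp.add_apply] at h4
        linarith
      rw [← sq_abs (l i + F.η θ i)]
      gcongr
    have h0 : 0 ≤ ∑ i, a i ^ 2 * (l i + F.η θ i) ^ 2 :=
      Finset.sum_nonneg fun i _ => by positivity
    have h3 : (∑ i, a i ^ 2 * (l i + F.η θ i) ^ 2) / (2 * ((q : ℝ) + 2)) ≤ ‖a‖ ^ 2 * Ψ θ := by
      refine (div_le_self h0 ?_).trans (h2.trans ?_)
      · have : (0 : ℝ) ≤ q := Nat.cast_nonneg q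
        linarith
      · gcongr
        exact hΨ2 θ
    have h4 : M * ‖a‖ ^ 2 ≤ ‖a‖ ^ 2 * Ψ θ := by
      rw [mul_comm]
      gcongr
      have h5 : M ≤ A + ‖F.η θ‖ := by
        have : 0 ≤ q * M := by positivity
        linarith [norm_nonneg (F.η θ)]
      exact h5.trans ((le_self_pow₀ (hΛ1 θ) (by norm_num)).trans (hΨ2 θ))
    have h5 : 0 ≤ (∑ i, a i ^ 2 * (l i + F.η θ i) ^ 2) / (2 * ((q : ℝ) + 2)) := by positivity
    have h6 : 0 ≤ ‖a‖ ^ 2 * Ψ θ := mul_nonneg (sq_nonneg _) (zero_le_one.trans (hΨ1 θ))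
    refine (abs_add_le _ _).trans ?_
    rw [abs_of_nonneg h5]
    linarith
  have hyx : ∀ θ, |h θ - 1 - x θ| ≤ 7 * (‖a‖ ^ 2) ^ 2 * Ψ θ := by
    intro θ
    refine (hexpand θ).2.2.trans ?_
    rw [← pow_mul]
    have := hΛ1 θ
    simp only [hΨ]
    gcongr
  have hhalf : ∀ θ, 1 / 2 ≤ h θ := fun θ => (hexpand θ).1
  -- With `s = ‖a‖²` the quadratic term is of order `s` and the expansion error of order `s²`, so
  -- the cubic error in `s` is the sixth power of `n‖ε‖`.
  obtain ⟨-, hlogi, hmain⟩ := ABC.abs_log_integral_sub_integral_log_le (P := P) (X := x)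
    (y := fun θ => h θ - 1) (Ψ := Ψ) (C := 7) (K := K') (s := ‖a‖ ^ 2) (sq_nonneg _)
    (pow_le_one₀ (norm_nonneg _) ha1) (by norm_num) hxm (hhi.1.sub aestronglyMeasurable_const) hΨm
    (ae_of_all _ hΨ1) hΨi hΨK (ae_of_all _ hxb) (ae_of_all _ hyx)
    (ae_of_all _ fun θ => by linarith [hhalf θ])
  simp only [add_sub_cancel] at hlogi hmain
  have h_int : ∫ θ, (h θ - 1) ∂P = ∫ θ, h θ ∂P - 1 := by
    rw [integral_sub hhi (integrable_const _)]
    simp [P]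
  obtain ⟨hp1, hp2, hp3⟩ := ABC.klDiv_withDensity_right (P := P) (h := h)
    (fun θ => lt_of_lt_of_le (by norm_num) (hhalf θ)) hhi hlogi
  have hPε' : Pε = P.withDensity fun θ => ENNReal.ofReal (h θ / ∫ θ', h θ' ∂P) := hPε
  rw [hPε']
  refine ⟨hprob, hp1, hmem, hp2, ?_⟩
  rw [hp3]
  rw [h_int, add_sub_cancel, ABC.integral_sq_centered
    (fun i => (hmem i).mono_exponent (by norm_num)) _ (n : ℝ), ← pow_mul] at hmain
  rw [← hα]
  exact hmain
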